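/- Let $d\ge 1$ be an integer and $\alpha\in(0,1)$. Let $\Phi(\theta)=\sum_{i=1}^d 4\sin^2(\theta_i/2)$ for $\theta\in[-\pi,\pi]^d$, and for $u\in\ell^2(\mathbb Z^d)$ (real-valued) let $\hat u(\theta)=\sum_{x\in\mathbb Z^d}u(x)e^{ix\cdot\theta}$, the series converging in $L^2([-\pi,\pi]^d)$. The discrete fractional Laplacian of $u\in\ell^2(\mathbb Z^d)$ is $$(-\Delta)^\alpha u(x)=\frac1{(2\pi)^d}\int_{[-\pi,\pi]^d}\Phi(\theta)^\alpha\,\hat u(\theta)\,e^{-ix\cdot\theta}\,d\theta ,\qquad x\in\mathbb Z^d.$$ Let $h:\mathbb Z^d\to\mathbb R$ and $f:\mathbb Z^d\times\mathbb R\to\mathbb R$, put $F(x,u)=\int_0^u f(x,t)\,dt$, and assume: ($h_1$) there are constants $c_1,c_2>0$ with $c_1\le h(x)\le c_2$ for all $x\in\mathbb Z^d$; ($f_1$) $f(x,\cdot)$ is continuous on $\mathbb R$ for every $x$; ($f_2$) there are $a>0$ and $p>2$ with $|f(x,u)|\le a(1+|u|^{p-1})$ for all $x,u$; ($f_3$)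 $f(x,u)=o(u)$ as $|u|\to0$, uniformly in $x$; ($f_4$) for every $x$, $u\mapsto f(x,u)/|u|$ is strictly increasing on $(-\infty,0)$ and on $(0,+\infty)$; ($f_5$) $F(x,u)/u^2\to+\infty$ as $|u|\to+\infty$, uniformly in $x$; ($f_6$) $h$ and $f$ are $1$-periodic in each coordinate $x_i$, $1\le i\le d$. Let $H^\alpha$ be the space of all $u\in\ell^2(\mathbb Z^d)$ for which $$\|u\|_\alpha^2=\frac1{(2\pi)^d}\int_{[-\pi,\pi]^d}\Phi(\theta)^\alpha|\hat u(\theta)|^2\,d\theta+\sum_{x\in\mathbb Z^d}h(x)u(x)^2$$ is finite, with the norm $\|\cdot\|_\alpha$, and let $$I(u)=\tfrac12\|u\|_\alpha^2-\sum_{x\in\mathbb Z^d}F(x,u(x)),\qquad \mathcal M=\{u\in H^\alpha\setminus\{0\}:\langle I'(u),u\rangle=0\}.$$ Then the equation $$(-\Delta)^\alpha u+h(x)u=f(x,u),\qquad x\in\mathbb Z^d,$$ has a ground state solution: there is $u\in H^\alpha$, $u\neq0$, with $I'(u)=0$ and $I(u)=\inf_{\mathcal M}I>0$, and this $u$ satisfies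 the equation at every $x\in\mathbb Z^d$. -/

import Mathlib

open MeasureTheory

noncomputable section

namespace FracSchrodinger

/-! ### The discrete Fourier transform -/

/-- The real sequence space `ℓ²(ℤᵈ)`. -/
abbrev EllTwo (d : ℕ) : Type := lp (fun _ : Fin d → ℤ => ℝ) 2

/-- Lebesgue measure on the cube `[-π, π]ᵈ`. -/
def cubeMeasure (d : ℕ) : Measure (Fin d → ℝ) :=
  volume.restrict (Set.univ.pi fun _ : Fin d => Set.Icc (-Real.pi) Real.pi)

instance (d : ℕ) : IsFiniteMeasure (cubeMeasure d) :=
  ⟨by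
    rw [cubeMeasure, Measure.restrict_apply_univ]
    exact (isCompact_univ_pi fun _ => isCompact_Icc).measure_lt_top⟩

/-- The function `θ ↦ e^{i x·θ}`. -/
def character {d : ℕ} (x : Fin d → ℤ) (θ : Fin d → ℝ) : ℂ :=
  Complex.exp (Complex.I * ∑ i, (x i : ℂ) * (θ i : ℂ))

theorem norm_character {d : ℕ} (x : Fin d → ℤ) (θ : Fin d → ℝ) : ‖character x θ‖ = 1 := by
  have h : Complex.I * ∑ i, (x i : ℂ) * (θ i : ℂ)
      = ((∑ i, (x i : ℝ) * θ i : ℝ) : ℂ) * Complex.I := by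
    push_cast; ring
  rw [character, h, Complex.norm_exp_ofReal_mul_I]

theorem continuous_character {d : ℕ} (x : Fin d → ℤ) : Continuous (character x) := by
  unfold character
  fun_prop

theorem memLp_character {d : ℕ} (x : Fin d → ℤ) : MemLp (character x) 2 (cubeMeasure d) :=
  MemLp.of_bound (continuous_character x).aestronglyMeasurable 1
    (Filter.Eventually.of_forall fun θ => (norm_character x θ).le)

/-- The function `θ ↦ e^{i x·θ}` as an element of `L²([-π, π]ᵈ; ℂ)`. -/
def characterLp {d : ℕ} (x : Fin d → ℤ) : Lp ℂ 2 (cubeMeasure d) :=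
  (memLp_character x).toLp (character x)

/-- The discrete Fourier transform `û = ∑ₓ u(x) e^{i x·θ}` of `u ∈ ℓ²(ℤᵈ)`; the series is
summed in `L²([-π, π]ᵈ; ℂ)`, where it converges by `hasSum_fourierTransform` below. -/
def fourierTransform {d : ℕ} (u : EllTwo d) : Lp ℂ 2 (cubeMeasure d) :=
  ∑' x, (u x : ℂ) • characterLp x

theorem integral_exp_int (n : ℤ) :
    ∫ t in Set.Icc (-Real.pi) Real.pi, Complex.exp (Complex.I * ((n : ℂ) * (t : ℂ)))
      = if n = 0 then ((2 * Real.pi : ℝ) : ℂ) else 0 := by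
  rw [integral_Icc_eq_integral_Ioc,
    ← intervalIntegral.integral_of_le (by linarith [Real.pi_pos])]
  split_ifs with hn
  · subst hn
    simp
    ring
  · have hc : Complex.I * (n : ℂ) ≠ 0 :=
      mul_ne_zero Complex.I_ne_zero (by exact_mod_cast hn)
    simp_rw [← mul_assoc]
    rw [integral_exp_mul_complex hc, div_eq_zero_iff]
    left
    rw [sub_eq_zero, Complex.exp_eq_exp_iff_exists_int]
    exact ⟨n, by push_cast; ring⟩

theorem inner_characterLp {d : ℕ} (x y : Fin d → ℤ) :
    inner ℂ (characterLp x) (characterLp y)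
      = if x = y then (((2 * Real.pi) ^ d : ℝ) : ℂ) else 0 := by
  have h1 : inner ℂ (characterLp x) (characterLp y)
      = ∫ θ, ∏ i, Complex.exp (Complex.I * (((y i - x i : ℤ) : ℂ) * (θ i : ℂ)))
          ∂(cubeMeasure d) := by
    rw [L2.inner_def]
    refine integral_congr_ae ?_
    filter_upwards [(memLp_character x).coeFn_toLp, (memLp_character y).coeFn_toLp] with θ hx hy
    simp only [characterLp, hx, hy, RCLike.inner_apply, character]
    rw [← Complex.exp_conj, ← Complex.exp_add, ← Complex.exp_sum]
    congr 1
    simp only [map_mul, map_sum, Complex.conj_I, Complex.conj_ofReal, Finset.mul_sum,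
      map_intCast, ← Finset.sum_add_distrib]
    refine Finset.sum_congr rfl fun i _ => ?_
    push_cast
    ring
  have h2 : cubeMeasure d = Measure.pi fun _ : Fin d =>
      (volume : Measure ℝ).restrict (Set.Icc (-Real.pi) Real.pi) := by
    rw [cubeMeasure, volume_pi, Measure.restrict_pi_pi]
  rw [h1, h2, integral_fintype_prod_eq_prod (𝕜 := ℂ) (fun (i : Fin d) (t : ℝ) =>
    Complex.exp (Complex.I * (((y i - x i : ℤ) : ℂ) * (t : ℂ))))]
  simp_rw [integral_exp_int]
  split_ifs with hxy
  · subst hxy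
    simp
  · obtain ⟨i, hi⟩ := Function.ne_iff.mp hxy
    refine Finset.prod_eq_zero (Finset.mem_univ i) (if_neg ?_)
    exact fun h => hi (sub_eq_zero.mp h).symm

theorem orthonormal_characterLp (d : ℕ) :
    Orthonormal ℂ fun x : Fin d → ℤ =>
      (((Real.sqrt ((2 * Real.pi) ^ d))⁻¹ : ℝ) : ℂ) • characterLp x := by
  rw [orthonormal_iff_ite]
  intro x y
  have hpos : 0 < (2 * Real.pi) ^ d := by positivity
  rw [inner_smul_left, inner_smul_right, inner_characterLp, Complex.conj_ofReal]
  split_ifs with hxy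
  · rw [← Complex.ofReal_mul, ← Complex.ofReal_mul, ← Complex.ofReal_one]
    congr 1
    have hs := Real.mul_self_sqrt hpos.le
    have hs0 : Real.sqrt ((2 * Real.pi) ^ d) ≠ 0 := (Real.sqrt_pos.mpr hpos).ne'
    field_simp
    nlinarith
  · simp

theorem summable_sq {d : ℕ} (u : EllTwo d) : Summable fun x => u x ^ 2 := by
  have h := (memℓp_gen_iff (by norm_num)).mp (lp.memℓp u)
  simpa using h

theorem hasSum_fourierTransform {d : ℕ} (u : EllTwo d) :
    HasSum (fun x => (u x : ℂ) • characterLp x) (fourierTransform u) := by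
  have hpos : 0 < (2 * Real.pi) ^ d := by positivity
  have hs0 : ((Real.sqrt ((2 * Real.pi) ^ d) : ℝ) : ℂ) ≠ 0 := by
    exact_mod_cast (Real.sqrt_pos.mpr hpos).ne'
  have h := ((orthonormal_characterLp d).orthogonalFamily.summable_iff_norm_sq_summable
    fun x => (u x : ℂ)).mpr (by simpa using summable_sq u)
  have h' := h.const_smul ((Real.sqrt ((2 * Real.pi) ^ d) : ℝ) : ℂ)
  refine Summable.hasSum (h'.congr fun x => ?_)
  simp only [LinearIsometry.toSpanSingleton_apply, smul_smul]
  congr 1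
  push_cast
  field_simp

theorem fourierTransform_add {d : ℕ} (u v : EllTwo d) :
    fourierTransform (u + v) = fourierTransform u + fourierTransform v := by
  refine (hasSum_fourierTransform (u + v)).unique ?_
  convert (hasSum_fourierTransform u).add (hasSum_fourierTransform v) using 2 with x
  simp [add_smul]

theorem fourierTransform_smul {d : ℕ} (c : ℝ) (u : EllTwo d) :
    fourierTransform (c • u) = (c : ℂ) • fourierTransform u := by
  refine (hasSum_fourierTransform (c • u)).unique ?_
  convert (hasSum_fourierTransform u).const_smul (c : ℂ) using 2 with x
  simp [mul_smul]

theorem fourierTransform_zero {d : ℕ} : fourierTransform (0 : EllTwo d) = 0 := by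
  simpa using fourierTransform_smul (0 : ℝ) (0 : EllTwo d)

/-- The inverse discrete Fourier transform. -/
def inverseFourierTransform {d : ℕ} (v : (Fin d → ℝ) → ℂ) (x : Fin d → ℤ) : ℂ :=
  (((2 * Real.pi) ^ d)⁻¹ : ℝ) *
    ∫ θ, v θ * Complex.exp (-(Complex.I * ∑ i, (x i : ℂ) * (θ i : ℂ))) ∂(cubeMeasure d)

/-! ### The fractional Laplacian -/

/-- The symbol `Φ(θ) = ∑ᵢ 4 sin²(θᵢ/2)` of `-Δ`. -/
def symbol {d : ℕ} (θ : Fin d → ℝ) : ℝ := ∑ i, 4 * Real.sin (θ i / 2) ^ 2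

theorem symbol_nonneg {d : ℕ} (θ : Fin d → ℝ) : 0 ≤ symbol θ :=
  Finset.sum_nonneg fun _ _ => by positivity

theorem measurable_symbol_rpow {d : ℕ} (α : ℝ) :
    Measurable fun θ : Fin d → ℝ => symbol θ ^ α := by
  unfold symbol
  fun_prop

/-- The discrete fractional Laplacian `(-Δ)^α u`: the function whose Fourier transform is
`Φ^α û`. Its values are real for real `u`; they are kept in `ℂ` so that no part of the
Fourier integral is discarded. -/
def fracLaplacian {d : ℕ} (α : ℝ) (u : EllTwo d) : (Fin d → ℤ) → ℂ :=
  inverseFourierTransform fun θ => ((symbol θ ^ α : ℝ) : ℂ) * fourierTransform u θ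

/-! ### The Hilbert space `H^α` -/

/-- `h` is bounded between two positive constants. -/
def BoundedPositive {d : ℕ} (h : (Fin d → ℤ) → ℝ) : Prop :=
  ∃ c₁ c₂ : ℝ, 0 < c₁ ∧ 0 < c₂ ∧ ∀ x, c₁ ≤ h x ∧ h x ≤ c₂

theorem BoundedPositive.pos {d : ℕ} {h : (Fin d → ℤ) → ℝ} (hh : BoundedPositive h)
    (x : Fin d → ℤ) : 0 < h x := by
  obtain ⟨c₁, c₂, h1, _, h2⟩ := hh
  exact h1.trans_le (h2 x).1

theorem integrable_cross {d : ℕ} {α : ℝ} {p q : Lp ℂ 2 (cubeMeasure d)}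
    (hp : Integrable (fun θ => symbol θ ^ α * ‖p θ‖ ^ 2) (cubeMeasure d))
    (hq : Integrable (fun θ => symbol θ ^ α * ‖q θ‖ ^ 2) (cubeMeasure d)) :
    Integrable (fun θ => ((symbol θ ^ α : ℝ) : ℂ) * p θ * starRingEnd ℂ (q θ))
      (cubeMeasure d) := by
  refine (hp.add hq).mono' ?_ (Filter.Eventually.of_forall fun θ => ?_)
  · have h1 := (Lp.aestronglyMeasurable p)
    have h2 := (Complex.continuous_conj.comp_aestronglyMeasurable (Lp.aestronglyMeasurable q))
    have h3 := (Complex.continuous_ofReal.measurable.comp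
      (measurable_symbol_rpow (d := d) α)).aestronglyMeasurable (μ := cubeMeasure d)
    exact (h3.mul h1).mul h2
  · have hΦ : 0 ≤ symbol θ ^ α := Real.rpow_nonneg (symbol_nonneg θ) α
    simp only [norm_mul, Complex.norm_real, Real.norm_of_nonneg hΦ, RCLike.norm_conj,
      Pi.add_apply]
    nlinarith [mul_nonneg hΦ (sq_nonneg (‖p θ‖ - ‖q θ‖)), mul_nonneg hΦ (sq_nonneg ‖p θ‖),
      mul_nonneg hΦ (sq_nonneg ‖q θ‖)]

theorem summable_cross {d : ℕ} {h : (Fin d → ℤ) → ℝ} {u v : EllTwo d}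
    (hu : Summable fun x => h x * u x ^ 2) (hv : Summable fun x => h x * v x ^ 2) :
    Summable fun x => h x * u x * v x := by
  refine Summable.of_norm_bounded (hu.abs.add hv.abs) fun x => ?_
  simp only [Real.norm_eq_abs, abs_mul, abs_pow]
  nlinarith [mul_nonneg (abs_nonneg (h x)) (sq_nonneg (|u x| - |v x|)),
    mul_nonneg (abs_nonneg (h x)) (sq_nonneg |u x|),
    mul_nonneg (abs_nonneg (h x)) (sq_nonneg |v x|)]

/-- The linear space of all `u ∈ ℓ²(ℤᵈ)` such that `∫ Φ^α |û|²` and `∑ h u²` are finite. -/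
def hSubmodule {d : ℕ} (α : ℝ) (h : (Fin d → ℤ) → ℝ) : Submodule ℝ (EllTwo d) where
  carrier := {u | Integrable (fun θ => symbol θ ^ α * ‖fourierTransform u θ‖ ^ 2)
      (cubeMeasure d) ∧ Summable fun x => h x * u x ^ 2}
  zero_mem' := by
    refine ⟨?_, by simp⟩
    rw [fourierTransform_zero]
    refine (integrable_zero _ ℝ _).congr ?_
    filter_upwards [Lp.coeFn_zero ℂ 2 (cubeMeasure d)] with θ hθ
    rw [hθ]
    simp
  add_mem' := by
    rintro u v ⟨hu1, hu2⟩ ⟨hv1, hv2⟩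
    constructor
    · rw [fourierTransform_add]
      have hc := (integrable_cross hu1 hv1).re.const_mul 2
      refine ((hu1.add hv1).add hc).congr ?_
      filter_upwards [Lp.coeFn_add (fourierTransform u) (fourierTransform v)] with θ hθ
      simp only [hθ, Pi.add_apply, ← Complex.normSq_eq_norm_sq, Complex.normSq_add, mul_assoc,
        RCLike.re_to_complex, Complex.re_ofReal_mul]
      ring
    · refine ((hu2.add hv2).add ((summable_cross hu2 hv2).mul_left 2)).congr fun x => ?_
      simp only [lp.coeFn_add, Pi.add_apply]
      ring
  smul_mem' := by
    rintro c u ⟨hu1, hu2⟩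
    constructor
    · rw [fourierTransform_smul]
      refine (hu1.const_mul (c ^ 2)).congr ?_
      filter_upwards [Lp.coeFn_smul (c : ℂ) (fourierTransform u)] with θ hθ
      simp only [hθ, Pi.smul_apply, smul_eq_mul, norm_mul, Complex.norm_real, mul_pow,
        Real.norm_eq_abs, sq_abs]
      ring
    · refine (hu2.mul_left (c ^ 2)).congr fun x => ?_
      simp only [lp.coeFn_smul, Pi.smul_apply, smul_eq_mul]
      ring

/-- The space `H^α`, to be normed by `‖u‖² = (2π)⁻ᵈ ∫ Φ^α |û|² + ∑ h u²`. It is a separate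
type so that it does not inherit the norm of `ℓ²(ℤᵈ)`; the positivity of `h`, carried as a
parameter, makes the form below definite. -/
def HSpace {d : ℕ} (α : ℝ) {h : (Fin d → ℤ) → ℝ} (_hh : BoundedPositive h) : Type :=
  hSubmodule α h

namespace HSpace

variable {d : ℕ} {α : ℝ} {h : (Fin d → ℤ) → ℝ} {hh : BoundedPositive h}

instance : AddCommGroup (HSpace α hh) := inferInstanceAs (AddCommGroup (hSubmodule α h))

instance : Module ℝ (HSpace α hh) := inferInstanceAs (Module ℝ (hSubmodule α h))

/-- The inclusion of `H^α` in `ℓ²(ℤᵈ)`. -/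
def toEllTwo : HSpace α hh →ₗ[ℝ] EllTwo d := (hSubmodule α h).subtype

instance : CoeFun (HSpace α hh) fun _ => (Fin d → ℤ) → ℝ := ⟨fun u => toEllTwo u⟩

theorem integrable_sq (u : HSpace α hh) :
    Integrable (fun θ => symbol θ ^ α * ‖fourierTransform (toEllTwo u) θ‖ ^ 2)
      (cubeMeasure d) := (show hSubmodule α h from u).2.1

theorem summable_mul_sq (u : HSpace α hh) : Summable fun x => h x * u x ^ 2 :=
  (show hSubmodule α h from u).2.2

/-- The inner product of `H^α`. For real `u` and `v` the integral is real. -/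
def form (u v : HSpace α hh) : ℝ :=
  ((2 * Real.pi) ^ d)⁻¹ *
      (∫ θ, ((symbol θ ^ α : ℝ) : ℂ) * fourierTransform (toEllTwo u) θ *
        starRingEnd ℂ (fourierTransform (toEllTwo v) θ) ∂(cubeMeasure d)).re +
    ∑' x, h x * u x * v x

theorem form_self (u : HSpace α hh) :
    form u u = ((2 * Real.pi) ^ d)⁻¹ *
        ∫ θ, symbol θ ^ α * ‖fourierTransform (toEllTwo u) θ‖ ^ 2 ∂(cubeMeasure d) +
      ∑' x, h x * u x ^ 2 := by
  unfold form
  congr 1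
  · congr 1
    rw [← Complex.ofReal_re (∫ θ, symbol θ ^ α * ‖fourierTransform (toEllTwo u) θ‖ ^ 2
      ∂(cubeMeasure d)), ← integral_complex_ofReal]
    congr 2
    funext θ
    rw [mul_assoc, Complex.mul_conj, Complex.normSq_eq_norm_sq]
    push_cast
    rfl
  · exact tsum_congr fun x => by ring

/-- The form `form` is a real inner product. -/
abbrev innerCore : InnerProductSpace.Core ℝ (HSpace α hh) where
  inner := form
  conj_inner_symm u v := by
    simp only [form, conj_trivial]
    congr 1
    · congr 1
      rw [← Complex.conj_re, ← integral_conj]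
      congr 2
      funext θ
      simp only [map_mul, Complex.conj_conj, Complex.conj_ofReal]
      ring
    · exact tsum_congr fun x => by ring
  re_inner_nonneg u := by
    change 0 ≤ form u u
    rw [form_self]
    refine add_nonneg (mul_nonneg (by positivity) (integral_nonneg fun θ => ?_))
      (tsum_nonneg fun x => mul_nonneg (hh.pos x).le (sq_nonneg _))
    exact mul_nonneg (Real.rpow_nonneg (symbol_nonneg θ) α) (sq_nonneg _)
  add_left u v w := by
    have h1 : ∫ θ, ((symbol θ ^ α : ℝ) : ℂ) * fourierTransform (toEllTwo (u + v)) θ *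
          starRingEnd ℂ (fourierTransform (toEllTwo w) θ) ∂(cubeMeasure d)
        = (∫ θ, ((symbol θ ^ α : ℝ) : ℂ) * fourierTransform (toEllTwo u) θ *
            starRingEnd ℂ (fourierTransform (toEllTwo w) θ) ∂(cubeMeasure d))
          + ∫ θ, ((symbol θ ^ α : ℝ) : ℂ) * fourierTransform (toEllTwo v) θ *
            starRingEnd ℂ (fourierTransform (toEllTwo w) θ) ∂(cubeMeasure d) := by
      rw [← integral_add (integrable_cross u.integrable_sq w.integrable_sq)
        (integrable_cross v.integrable_sq w.integrable_sq), map_add, fourierTransform_add]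
      refine integral_congr_ae ?_
      filter_upwards [Lp.coeFn_add (fourierTransform (toEllTwo u))
        (fourierTransform (toEllTwo v))] with θ hθ
      rw [hθ, Pi.add_apply]
      ring
    have h2 : ∑' x, h x * (u + v) x * w x
        = (∑' x, h x * u x * w x) + ∑' x, h x * v x * w x := by
      rw [← (summable_cross u.summable_mul_sq w.summable_mul_sq).tsum_add
        (summable_cross v.summable_mul_sq w.summable_mul_sq)]
      refine tsum_congr fun x => ?_
      simp only [map_add, lp.coeFn_add, Pi.add_apply]
      ring
    change form (u + v) w = form u w + form v w
    simp only [form]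
    rw [h1, h2, Complex.add_re]
    ring
  smul_left u v c := by
    have h1 : ∫ θ, ((symbol θ ^ α : ℝ) : ℂ) * fourierTransform (toEllTwo (c • u)) θ *
          starRingEnd ℂ (fourierTransform (toEllTwo v) θ) ∂(cubeMeasure d)
        = (c : ℂ) * ∫ θ, ((symbol θ ^ α : ℝ) : ℂ) * fourierTransform (toEllTwo u) θ *
            starRingEnd ℂ (fourierTransform (toEllTwo v) θ) ∂(cubeMeasure d) := by
      rw [← integral_const_mul, map_smul, fourierTransform_smul]
      refine integral_congr_ae ?_
      filter_upwards [Lp.coeFn_smul (c : ℂ) (fourierTransform (toEllTwo u))] with θ hθ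
      rw [hθ, Pi.smul_apply, smul_eq_mul]
      ring
    have h2 : ∑' x, h x * (c • u) x * v x = c * ∑' x, h x * u x * v x := by
      rw [← tsum_mul_left]
      refine tsum_congr fun x => ?_
      simp only [map_smul, lp.coeFn_smul, Pi.smul_apply, smul_eq_mul]
      ring
    change form (c • u) v = c * form u v
    simp only [form]
    rw [h1, h2, Complex.re_ofReal_mul]
    ring
  definite u hu := by
    change form u u = 0 at hu
    rw [form_self] at hu
    have h1 : 0 ≤ ((2 * Real.pi) ^ d)⁻¹ *
        ∫ θ, symbol θ ^ α * ‖fourierTransform (toEllTwo u) θ‖ ^ 2 ∂(cubeMeasure d) :=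
      mul_nonneg (by positivity) (integral_nonneg fun θ =>
        mul_nonneg (Real.rpow_nonneg (symbol_nonneg θ) α) (sq_nonneg _))
    have h2 : ∀ x, 0 ≤ h x * u x ^ 2 := fun x => mul_nonneg (hh.pos x).le (sq_nonneg _)
    have h3 : ∑' x, h x * u x ^ 2 = 0 := by 
      have h2' : 0 ≤ ∑' x, h x * u x ^ 2 := tsum_nonneg h2
      linarith
    have h4 := (hasSum_zero_iff_of_nonneg h2).mp (h3 ▸ u.summable_mul_sq.hasSum)
    refine Subtype.ext (lp.ext (funext fun x => ?_))
    have h5 : h x * u x ^ 2 = 0 := congrFun h4 x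
    exact pow_eq_zero_iff (two_ne_zero) |>.mp
      ((mul_eq_zero.mp h5).resolve_left (hh.pos x).ne')

instance : NormedAddCommGroup (HSpace α hh) :=
  InnerProductSpace.Core.toNormedAddCommGroup (𝕜 := ℝ) (cd := innerCore)

instance : InnerProductSpace ℝ (HSpace α hh) :=
  InnerProductSpace.ofCore innerCore.toCore

theorem norm_sq_eq (u : HSpace α hh) :
    ‖u‖ ^ 2 = ((2 * Real.pi) ^ d)⁻¹ *
        ∫ θ, symbol θ ^ α * ‖fourierTransform (toEllTwo u) θ‖ ^ 2 ∂(cubeMeasure d) +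
      ∑' x, h x * u x ^ 2 := by
  rw [← form_self, ← real_inner_self_eq_norm_sq]
  rfl

end HSpace

/-! ### Energy, Nehari manifold and ground states -/

/-- The primitive `F(x, u) = ∫₀ᵘ f(x, t) dt`. -/
def primitive {d : ℕ} (f : (Fin d → ℤ) → ℝ → ℝ) (x : Fin d → ℤ) (u : ℝ) : ℝ :=
  ∫ t in (0 : ℝ)..u, f x t

variable {d : ℕ} {α : ℝ} {h : (Fin d → ℤ) → ℝ} {hh : BoundedPositive h}

/-- The energy functional `I(u) = ‖u‖² / 2 - ∑ₓ F(x, u(x))` on `H^α`. -/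
def energy (f : (Fin d → ℤ) → ℝ → ℝ) (u : HSpace α hh) : ℝ :=
  1 / 2 * ‖u‖ ^ 2 - ∑' x, primitive f x (u x)

/-- The Nehari manifold `{u ∈ H^α \ {0} : ⟨I'(u), u⟩ = 0}`. -/
def nehari (α : ℝ) (hh : BoundedPositive h) (f : (Fin d → ℤ) → ℝ → ℝ) : Set (HSpace α hh) :=
  {u | u ≠ 0 ∧ fderiv ℝ (energy f) u u = 0}

/-- `u` is a ground state: a nontrivial critical point of `I` with `I(u) = inf I > 0`, the
infimum being taken over the Nehari manifold. -/
def IsGroundState (f : (Fin d → ℤ) → ℝ → ℝ) (u : HSpace α hh) : Prop :=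
  u ≠ 0 ∧ HasFDerivAt (energy f) (0 : HSpace α hh →L[ℝ] ℝ) u ∧
    IsGLB (energy f '' nehari α hh f) (energy f u) ∧ 0 < energy f u

/-- `u` solves `(-Δ)^α u + h u = f(x, u)` at every point of `ℤᵈ`. -/
def IsSolution (α : ℝ) (h : (Fin d → ℤ) → ℝ) (f : (Fin d → ℤ) → ℝ → ℝ) (u : EllTwo d) : Prop :=
  ∀ x, fracLaplacian α u x + (h x : ℂ) * (u x : ℂ) = (f x (u x) : ℂ)

end FracSchrodinger

end

open MeasureTheory

noncomputable section

namespace FracSchrodinger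

open Filter Topology

/-! ### Scalar functions vanishing to a given order at the origin -/

/-- `φ` is continuous and `φ u = o(|u| ^ k)` as `u → 0`. -/
structure VanishesToOrder (k : ℕ) (φ : ℝ → ℝ) : Prop where
  continuous : Continuous φ
  small : ∀ ε : ℝ, 0 < ε → ∃ δ : ℝ, 0 < δ ∧ ∀ u, |u| < δ → |φ u| ≤ ε * |u| ^ k

namespace VanishesToOrder

variable {k : ℕ} {φ ψ : ℝ → ℝ}

theorem apply_zero (hφ : VanishesToOrder k φ) (hk : k ≠ 0) : φ 0 = 0 := by
  obtain ⟨δ, hδ, h⟩ := hφ.small 1 one_pos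
  simpa [hk] using h 0 (by simpa using hδ)

theorem sub (hφ : VanishesToOrder k φ) (hψ : VanishesToOrder k ψ) :
    VanishesToOrder k fun u => φ u - ψ u := by
  refine ⟨hφ.continuous.sub hψ.continuous, fun ε hε => ?_⟩
  obtain ⟨δ₁, hδ₁, h₁⟩ := hφ.small (ε / 2) (half_pos hε)
  obtain ⟨δ₂, hδ₂, h₂⟩ := hψ.small (ε / 2) (half_pos hε)
  refine ⟨min δ₁ δ₂, lt_min hδ₁ hδ₂, fun u hu => ?_⟩
  have a₁ := h₁ u (hu.trans_le (min_le_left _ _))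
  have a₂ := h₂ u (hu.trans_le (min_le_right _ _))
  calc |φ u - ψ u| ≤ |φ u| + |ψ u| := abs_sub _ _
    _ ≤ ε * |u| ^ k := by linarith

theorem const_mul (hφ : VanishesToOrder k φ) (c : ℝ) :
    VanishesToOrder k fun u => c * φ u := by
  refine ⟨continuous_const.mul hφ.continuous, fun ε hε => ?_⟩
  obtain ⟨δ, hδ, h⟩ := hφ.small (ε / (|c| + 1)) (by positivity)
  refine ⟨δ, hδ, fun u hu => ?_⟩
  rw [abs_mul]
  calc |c| * |φ u| ≤ (|c| + 1) * (ε / (|c| + 1) * |u| ^ k) := by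
        gcongr
        · linarith
        · exact h u hu
    _ = ε * |u| ^ k := by field_simp

theorem mul_id (hφ : VanishesToOrder k φ) : VanishesToOrder (k + 1) fun u => φ u * u := by
  refine ⟨hφ.continuous.mul continuous_id, fun ε hε => ?_⟩
  obtain ⟨δ, hδ, h⟩ := hφ.small ε hε
  refine ⟨δ, hδ, fun u hu => ?_⟩
  rw [abs_mul, pow_succ, ← mul_assoc]
  exact mul_le_mul_of_nonneg_right (h u hu) (abs_nonneg u)

theorem primitive (hφ : VanishesToOrder k φ) :
    VanishesToOrder (k + 1) fun u => ∫ t in (0 : ℝ)..u, φ t := by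
  refine ⟨intervalIntegral.continuous_primitive
    (fun a b => hφ.continuous.intervalIntegrable a b) 0, fun ε hε => ?_⟩
  obtain ⟨δ, hδ, h⟩ := hφ.small ε hε
  refine ⟨δ, hδ, fun u hu => ?_⟩
  have := intervalIntegral.norm_integral_le_of_norm_le_const (f := φ) (a := 0) (b := u)
    (C := ε * |u| ^ k) fun t ht => by
      have htu : |t| ≤ |u| := by
        rcases le_total 0 u with h0 | h0
        · rw [Set.uIoc_of_le h0] at ht
          rw [abs_of_pos ht.1, abs_of_nonneg h0]; exact ht.2
        · rw [Set.uIoc_of_ge h0] at ht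
          rw [abs_of_nonpos ht.2, abs_of_nonpos h0]; linarith [ht.1]
      calc ‖φ t‖ ≤ ε * |t| ^ k := h t (htu.trans_lt hu)
        _ ≤ ε * |u| ^ k := by gcongr
  simpa [pow_succ, mul_assoc] using this

/-- On bounded sets, the increments of `φ` are controlled by a small multiple of `|a| ^ k` and a
large multiple of `|b| ^ k`. -/
theorem increment_bound (hφ : VanishesToOrder k φ) (B : ℝ) {ε : ℝ} (hε : 0 < ε) :
    ∃ K : ℝ, 0 ≤ K ∧ ∀ a b : ℝ, |a| ≤ B → |b| ≤ B →
      |φ (a + b) - φ a| ≤ ε * |a| ^ k + K * |b| ^ k := by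
  have hε' : 0 < ε / (2 ^ k + 1) := by positivity
  obtain ⟨δ, hδ, hsm⟩ := hφ.small _ hε'
  have hcpt : IsCompact (Set.Icc (-(2 * B)) (2 * B)) := isCompact_Icc
  have huc := Metric.uniformContinuousOn_iff.mp
    (hcpt.uniformContinuousOn_of_continuous hφ.continuous.continuousOn)
  obtain ⟨η₀, hη₀, huc⟩ := huc (ε * (δ / 2) ^ k) (by positivity)
  obtain ⟨M, hM⟩ := hcpt.exists_bound_of_continuousOn hφ.continuous.continuousOn
  set η := min η₀ (δ / 2) with hη
  have hηpos : 0 < η := lt_min hη₀ (half_pos hδ)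
  refine ⟨max ε (2 * M / η ^ k), le_max_of_le_left hε.le, fun a b ha hb => ?_⟩
  have hmem : a ∈ Set.Icc (-(2 * B)) (2 * B) := by
    have := abs_le.mp ha; have := abs_nonneg a
    constructor <;> linarith
  have hmem' : a + b ∈ Set.Icc (-(2 * B)) (2 * B) := by
    have := abs_le.mp ha; have := abs_le.mp hb
    constructor <;> linarith
  have hak : 0 ≤ |a| ^ k := by positivity
  have hbk : 0 ≤ |b| ^ k := by positivity
  have hK1 : ε * |b| ^ k ≤ max ε (2 * M / η ^ k) * |b| ^ k :=
    mul_le_mul_of_nonneg_right (le_max_left _ _) hbk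
  have hK2 : 2 * M / η ^ k * |b| ^ k ≤ max ε (2 * M / η ^ k) * |b| ^ k :=
    mul_le_mul_of_nonneg_right (le_max_right _ _) hbk
  have hea : 0 ≤ ε * |a| ^ k := by positivity
  have heb : 0 ≤ ε * |b| ^ k := by positivity
  rcases le_or_gt η |b| with h1 | h1
  · have hM0 : 0 ≤ M := (norm_nonneg _).trans (hM a hmem)
    have h2 : |φ (a + b) - φ a| ≤ 2 * M := by
      have e1 := hM _ hmem
      have e2 := hM _ hmem'
      rw [Real.norm_eq_abs] at e1 e2
      calc |φ (a + b) - φ a| ≤ |φ (a + b)| + |φ a| := abs_sub _ _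
        _ ≤ 2 * M := by linarith
    have h3 : 2 * M ≤ 2 * M / η ^ k * |b| ^ k := by
      rw [div_mul_eq_mul_div, le_div_iff₀ (by positivity)]
      gcongr
    linarith
  · rcases lt_or_ge |a| (δ / 2) with h2 | h2
    · have hbδ : |b| < δ / 2 := h1.trans_le (min_le_right _ _)
      have e1 := hsm a (by linarith)
      have e2 := hsm (a + b) ((abs_add_le a b).trans_lt (by linarith))
      have e3 : |a + b| ^ k ≤ 2 ^ k * (|a| ^ k + |b| ^ k) := by
        have hm : |a + b| ≤ 2 * max |a| |b| := by
          have := abs_add_le a b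
          have := le_max_left |a| |b|
          have := le_max_right |a| |b|
          linarith
        calc |a + b| ^ k ≤ (2 * max |a| |b|) ^ k := by gcongr
          _ = 2 ^ k * (max |a| |b|) ^ k := mul_pow _ _ _
          _ ≤ 2 ^ k * (|a| ^ k + |b| ^ k) := by
            gcongr
            rcases max_choice |a| |b| with h | h <;> rw [h] <;> linarith
      have e4 : ε / (2 ^ k + 1) * |a + b| ^ k
          ≤ ε / (2 ^ k + 1) * (2 ^ k * (|a| ^ k + |b| ^ k)) := by gcongr
      have e5 : ε / (2 ^ k + 1) * (2 ^ k * (|a| ^ k + |b| ^ k)) + ε / (2 ^ k + 1) * |a| ^ k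
          ≤ ε * |a| ^ k + ε * |b| ^ k := by
        have : ε * |a| ^ k + ε * |b| ^ k = ε / (2 ^ k + 1) * (2 ^ k * (|a| ^ k + |b| ^ k))
            + ε / (2 ^ k + 1) * |a| ^ k + ε / (2 ^ k + 1) * |b| ^ k := by
          field_simp; ring
        have : 0 ≤ ε / (2 ^ k + 1) * |b| ^ k := by positivity
        linarith
      calc |φ (a + b) - φ a| ≤ |φ (a + b)| + |φ a| := abs_sub _ _
        _ ≤ _ := by linarith
    · have e1 := huc (a + b) hmem' a hmem (by
        rw [Real.dist_eq, add_sub_cancel_left]; exact h1.trans_le (min_le_left _ _))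
      rw [Real.dist_eq] at e1
      have e2 : ε * (δ / 2) ^ k ≤ ε * |a| ^ k := by gcongr
      linarith

/-- On bounded sets, `φ` is bounded by a multiple of `|b| ^ k`. -/
theorem exists_bound (hφ : VanishesToOrder k φ) (hk : k ≠ 0) (B : ℝ) :
    ∃ K : ℝ, 0 ≤ K ∧ ∀ b : ℝ, |b| ≤ B → |φ b| ≤ K * |b| ^ k := by
  obtain ⟨K, hK, h⟩ := hφ.increment_bound B one_pos
  refine ⟨K, hK, fun b hb => ?_⟩
  simpa [hφ.apply_zero hk, hk] using h 0 b (by simpa using (abs_nonneg b).trans hb) hb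

end VanishesToOrder

/-! ### Superposition functionals on `ℓ²` -/

section Superposition

variable {ι : Type*}

local notation "ℓ²" => lp (fun _ : ι => ℝ) 2

theorem lp_summable_sq (v : ℓ²) : Summable fun x => v x ^ 2 := by
  have h := (memℓp_gen_iff (by norm_num)).mp (lp.memℓp v)
  simpa using h

theorem lp_norm_sq (v : ℓ²) : ‖v‖ ^ 2 = ∑' x, v x ^ 2 := by
  have h := lp.norm_rpow_eq_tsum (p := 2) (by norm_num) v
  simpa using h

theorem lp_abs_apply_le (v : ℓ²) (x : ι) : |v x| ≤ ‖v‖ :=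
  lp.norm_apply_le_norm (by norm_num) v x

theorem lp_summable_mul (v w : ℓ²) : Summable fun x => |v x| * |w x| := by
  refine Summable.of_nonneg_of_le (fun x => by positivity) (fun x => ?_)
    ((lp_summable_sq v).add (lp_summable_sq w))
  rw [← sq_abs (v x), ← sq_abs (w x)]
  nlinarith [sq_nonneg (|v x| - |w x|), abs_nonneg (v x), abs_nonneg (w x)]

theorem lp_tsum_mul_le (v w : ℓ²) : ∑' x, |v x| * |w x| ≤ ‖v‖ * ‖w‖ := by
  have h := Real.inner_le_Lp_mul_Lq_tsum_of_nonneg (p := 2) (q := 2)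
    (by constructor <;> norm_num) (f := fun x => |v x|) (g := fun x => |w x|)
    (fun x => abs_nonneg _) (fun x => abs_nonneg _)
    (by simpa using lp_summable_sq v) (by simpa using lp_summable_sq w)
  have e : ∀ z : ℓ², (∑' x, |z x| ^ (2 : ℝ)) ^ (1 / 2 : ℝ) = ‖z‖ := fun z => by
    simp only [Real.rpow_two, sq_abs]
    rw [← lp_norm_sq, ← Real.sqrt_eq_rpow, Real.sqrt_sq (norm_nonneg z)]
  rw [e, e] at h
  exact h

variable {φ : ℝ → ℝ}

theorem VanishesToOrder.summable (hφ : VanishesToOrder 2 φ) (v : ℓ²) :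
    Summable fun x => φ (v x) := by
  obtain ⟨K, hK, h⟩ := hφ.exists_bound two_ne_zero ‖v‖
  refine Summable.of_norm_bounded ((lp_summable_sq v).mul_left K) fun x => ?_
  simpa using h (v x) (lp_abs_apply_le v x)

theorem VanishesToOrder.abs_tsum_sub_le (hφ : VanishesToOrder 2 φ) (B : ℝ) {ε : ℝ}
    (hε : 0 < ε) : ∃ K : ℝ, 0 ≤ K ∧ ∀ v w : ℓ², ‖v‖ ≤ B → ‖w‖ ≤ B →
      |∑' x, φ ((v + w) x) - ∑' x, φ (v x)| ≤ ε * ‖v‖ ^ 2 + K * ‖w‖ ^ 2 := by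
  obtain ⟨K, hK, h⟩ := hφ.increment_bound B hε
  refine ⟨K, hK, fun v w hv hw => ?_⟩
  rw [← (hφ.summable _).tsum_sub (hφ.summable _), lp_norm_sq, lp_norm_sq, ← tsum_mul_left,
    ← tsum_mul_left, ← ((lp_summable_sq v).mul_left ε).tsum_add ((lp_summable_sq w).mul_left K)]
  rw [← Real.norm_eq_abs]
  refine tsum_of_norm_bounded (((lp_summable_sq v).mul_left ε).add
    ((lp_summable_sq w).mul_left K)).hasSum fun x => ?_
  simpa using h (v x) (w x) ((lp_abs_apply_le v x).trans hv) ((lp_abs_apply_le w x).trans hw)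

theorem VanishesToOrder.continuous_tsum (hφ : VanishesToOrder 2 φ) :
    Continuous fun v : ℓ² => ∑' x, φ (v x) := by
  rw [Metric.continuous_iff]
  intro v ε hε
  set B := ‖v‖ + 1
  have hB0 : 0 < B := by positivity
  obtain ⟨K, hK, h⟩ := hφ.abs_tsum_sub_le (ι := ι) B (ε := ε / 2 / B ^ 2) (by positivity)
  obtain ⟨δ, hδ, hδε⟩ : ∃ δ : ℝ, 0 < δ ∧ K * δ ^ 2 < ε / 2 := by
    have ht : Tendsto (fun δ : ℝ => K * δ ^ 2) (𝓝[>] 0) (𝓝 (K * 0 ^ 2)) :=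
      ((continuous_const.mul (continuous_pow 2)).tendsto 0).mono_left nhdsWithin_le_nhds
    have := (ht.eventually_lt_const (u := ε / 2) (by simpa using hε)).and
      self_mem_nhdsWithin
    obtain ⟨δ, h1, h2⟩ := this.exists
    exact ⟨δ, h2, h1⟩
  refine ⟨min δ 1, lt_min hδ one_pos, fun w hw => ?_⟩
  rw [dist_eq_norm] at hw
  have hvB : ‖v‖ ≤ B := by simp [B]
  have h1 := h v (w - v) hvB (hw.le.trans ((min_le_right _ _).trans (by simp [B])))
  rw [add_sub_cancel] at h1
  rw [Real.dist_eq]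
  have h2 : ε / 2 / B ^ 2 * ‖v‖ ^ 2 ≤ ε / 2 := by
    calc ε / 2 / B ^ 2 * ‖v‖ ^ 2 ≤ ε / 2 / B ^ 2 * B ^ 2 := by gcongr
      _ = ε / 2 := by field_simp
  have h3 : K * ‖w - v‖ ^ 2 ≤ K * δ ^ 2 := by
    gcongr
    exact hw.le.trans (min_le_left _ _)
  linarith

/-- A form of dominated convergence: up to small multiples of a bounded sequence in `ℓ²`, the
terms are dominated by summable functions. -/
theorem tendsto_tsum_of_almost_dominated {ψ : ℕ → ι → ℝ} {w : ℕ → ℓ²} {B : ℝ}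
    (hB : ∀ n, ‖w n‖ ≤ B) (hψ : ∀ x, Tendsto (fun n => ψ n x) atTop (𝓝 0))
    (hdom : ∀ ε : ℝ, 0 < ε → ∃ b : ι → ℝ, Summable b ∧ ∀ n x, |ψ n x| ≤ ε * w n x ^ 2 + b x) :
    Tendsto (fun n => ∑' x, ψ n x) atTop (𝓝 0) := by
  rw [Metric.tendsto_atTop]
  intro ε hε
  have hB0 : 0 ≤ B := (norm_nonneg _).trans (hB 0)
  obtain ⟨b, hb, hle⟩ := hdom (ε / 2 / (B ^ 2 + 1)) (by positivity)
  set η := ε / 2 / (B ^ 2 + 1)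
  have hη : 0 < η := by positivity
  have hb0 : ∀ n x, max (|ψ n x| - η * w n x ^ 2) 0 ≤ |b x| := fun n x =>
    max_le ((by linarith [hle n x] : _ ≤ b x).trans (le_abs_self _)) (abs_nonneg _)
  have hlim : Tendsto (fun n => ∑' x, max (|ψ n x| - η * w n x ^ 2) 0) atTop
      (𝓝 (∑' _ : ι, (0 : ℝ))) := by
    refine tendsto_tsum_of_dominated_convergence hb.abs (fun x => ?_)
      (Eventually.of_forall fun n x => ?_)
    · refine squeeze_zero (fun n => le_max_right _ _) (fun n => ?_) (by simpa using (hψ x).abs)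
      exact max_le (by have : 0 ≤ η * w n x ^ 2 := by positivity
                       linarith) (abs_nonneg _)
    · rw [Real.norm_of_nonneg (le_max_right _ _)]
      exact hb0 n x
  rw [tsum_zero] at hlim
  obtain ⟨N, hN⟩ := Metric.tendsto_atTop.mp hlim (ε / 2) (half_pos hε)
  refine ⟨N, fun n hn => ?_⟩
  have h1 := hN n hn
  rw [Real.dist_0_eq_abs] at h1 ⊢
  have hs1 : Summable fun x => max (|ψ n x| - η * w n x ^ 2) 0 :=
    Summable.of_nonneg_of_le (fun x => le_max_right _ _) (hb0 n) hb.abs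
  have hs2 := (lp_summable_sq (w n)).mul_left η
  have h2 : |∑' x, ψ n x| ≤ ∑' x, (max (|ψ n x| - η * w n x ^ 2) 0 + η * w n x ^ 2) := by
    rw [← Real.norm_eq_abs]
    refine tsum_of_norm_bounded (hs1.add hs2).hasSum fun x => ?_
    rw [Real.norm_eq_abs]
    linarith [le_max_left (|ψ n x| - η * w n x ^ 2) 0]
  rw [hs1.tsum_add hs2, tsum_mul_left, ← lp_norm_sq] at h2
  have h3 : η * ‖w n‖ ^ 2 ≤ ε / 2 := by
    calc η * ‖w n‖ ^ 2 ≤ η * (B ^ 2 + 1) := by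
          gcongr
          have : ‖w n‖ ^ 2 ≤ B ^ 2 := by gcongr; exact hB n
          linarith
      _ = ε / 2 := by simp only [η]; field_simp
  linarith [le_abs_self (∑' x, max (|ψ n x| - η * w n x ^ 2) 0)]

/-- The Brezis–Lieb splitting of superposition functionals. -/
theorem VanishesToOrder.tendsto_tsum_add_sub (hφ : VanishesToOrder 2 φ) (v : ℓ²)
    {w : ℕ → ℓ²} {B : ℝ} (hB : ∀ n, ‖w n‖ ≤ B)
    (hw : ∀ x, Tendsto (fun n => w n x) atTop (𝓝 0)) :
    Tendsto (fun n => ∑' x, φ ((v + w n) x) - ∑' x, φ (w n x)) atTop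
      (𝓝 (∑' x, φ (v x))) := by
  rw [← tendsto_sub_nhds_zero_iff]
  have hEq : ∀ n, (∑' x, φ ((v + w n) x) - ∑' x, φ (w n x)) - ∑' x, φ (v x)
      = ∑' x, (φ ((v + w n) x) - φ (w n x) - φ (v x)) := fun n => by
    rw [((hφ.summable _).sub (hφ.summable _)).tsum_sub (hφ.summable _),
      (hφ.summable _).tsum_sub (hφ.summable _)]
  simp_rw [hEq]
  refine tendsto_tsum_of_almost_dominated hB (fun x => ?_) fun ε hε => ?_
  · have h1 : Tendsto (fun n => φ (v x + w n x) - φ (w n x) - φ (v x)) atTop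
        (𝓝 (φ (v x + 0) - φ 0 - φ (v x))) :=
      ((hφ.continuous.tendsto _).comp (tendsto_const_nhds.add (hw x))).sub
        ((hφ.continuous.tendsto _).comp (hw x)) |>.sub tendsto_const_nhds
    simpa [hφ.apply_zero two_ne_zero] using h1
  · obtain ⟨K, hK, h⟩ := hφ.increment_bound (max B ‖v‖) hε
    obtain ⟨L, hL, h'⟩ := hφ.exists_bound two_ne_zero ‖v‖
    refine ⟨fun x => (K + L) * v x ^ 2, (lp_summable_sq v).mul_left _, fun n x => ?_⟩
    have e1 := h (w n x) (v x) (((lp_abs_apply_le _ x).trans (hB n)).trans (le_max_left _ _))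
      ((lp_abs_apply_le _ x).trans (le_max_right _ _))
    have e2 := h' (v x) (lp_abs_apply_le _ x)
    rw [sq_abs] at e1 e2
    rw [sq_abs] at e1
    have e3 : (v + w n) x = w n x + v x := by rw [add_comm]; rfl
    rw [e3]
    calc |φ (w n x + v x) - φ (w n x) - φ (v x)|
        ≤ |φ (w n x + v x) - φ (w n x)| + |φ (v x)| := abs_sub _ _
      _ ≤ _ := by linarith

/-- A bounded sequence in `ℓ²` tending pointwise to zero tends weakly to zero. -/
theorem lp_tendsto_dual_zero {w : ℕ → ℓ²} {B : ℝ} (hB : ∀ n, ‖w n‖ ≤ B)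
    (hw : ∀ x, Tendsto (fun n => w n x) atTop (𝓝 0)) (L : ℓ² →L[ℝ] ℝ) :
    Tendsto (fun n => L (w n)) atTop (𝓝 0) := by
  obtain ⟨a, ha⟩ := (InnerProductSpace.toDual ℝ ℓ²).surjective L
  have hL : ∀ n, L (w n) = ∑' x, w n x * a x := fun n => by
    rw [← ha, InnerProductSpace.toDual_apply_apply, lp.inner_eq_tsum]
    exact tsum_congr fun x => by simp
  simp_rw [hL]
  refine tendsto_tsum_of_almost_dominated hB (fun x => ?_) fun ε hε => ?_
  · simpa using (hw x).mul_const (a x)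
  · refine ⟨fun x => 1 / ε * a x ^ 2, (lp_summable_sq a).mul_left _, fun n x => ?_⟩
    beta_reduce
    rw [abs_mul, ← sq_abs (w n x), ← sq_abs (a x)]
    have : ε * |w n x| ^ 2 + 1 / ε * |a x| ^ 2 - |w n x| * |a x|
        = (ε * |w n x| - |a x|) ^ 2 / ε + |w n x| * |a x| := by field_simp; ring
    have : 0 ≤ (ε * |w n x| - |a x|) ^ 2 / ε + |w n x| * |a x| := by positivity
    linarith

theorem VanishesToOrder.memℓp (hφ : VanishesToOrder 1 φ) (v : ℓ²) :
    Memℓp (fun x => φ (v x)) 2 := by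
  obtain ⟨K, hK, h⟩ := hφ.exists_bound one_ne_zero ‖v‖
  refine memℓp_gen ?_
  refine Summable.of_nonneg_of_le (fun x => by positivity) (fun x => ?_)
    ((lp_summable_sq v).mul_left (K ^ 2))
  have h1 := h (v x) (lp_abs_apply_le v x)
  rw [pow_one] at h1
  simp only [ENNReal.toReal_ofNat, Real.rpow_two, Real.norm_eq_abs]
  calc |φ (v x)| ^ 2 ≤ (K * |v x|) ^ 2 := by gcongr
    _ = K ^ 2 * v x ^ 2 := by rw [mul_pow, sq_abs]

/-- The superposition operator `v ↦ φ ∘ v` on `ℓ²`. -/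
def superposition (hφ : VanishesToOrder 1 φ) (v : ℓ²) : ℓ² := ⟨fun x => φ (v x), hφ.memℓp v⟩

@[simp] theorem superposition_apply (hφ : VanishesToOrder 1 φ) (v : ℓ²) (x : ι) :
    superposition hφ v x = φ (v x) := rfl

theorem VanishesToOrder.hasStrictFDerivAt_tsum_primitive (hφ : VanishesToOrder 1 φ) (v : ℓ²) :
    HasStrictFDerivAt (fun v : ℓ² => ∑' x, ∫ t in (0 : ℝ)..v x, φ t)
      (innerSL ℝ (superposition hφ v)) v := by
  have hF := hφ.primitive
  refine HasStrictFDerivAt.of_isLittleO ?_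
  rw [Asymptotics.isLittleO_iff]
  intro c hc
  obtain ⟨K, hK, h⟩ := hφ.increment_bound (‖v‖ + 2) (ε := c / 2 / (‖v‖ + 1)) (by positivity)
  have hr : 0 < min 1 (c / 4 / (K + 1)) := lt_min one_pos (by positivity)
  filter_upwards [prod_mem_nhds (Metric.ball_mem_nhds v hr) (Metric.ball_mem_nhds v hr)]
  rintro ⟨y, z⟩ ⟨hy, hz⟩
  simp only [Metric.mem_ball, dist_eq_norm] at hy hz
  have hy1 := hy.trans_le (min_le_left _ _)
  have hy2 := hy.trans_le (min_le_right _ _)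
  have hz1 := hz.trans_le (min_le_left _ _)
  have hz2 := hz.trans_le (min_le_right _ _)
  set ε := c / 2 / (‖v‖ + 1)
  have hε : 0 < ε := by positivity
  have hin : innerSL ℝ (superposition hφ v) (y - z) = ∑' x, φ (v x) * (y - z) x := by
    rw [innerSL_apply_apply, lp.inner_eq_tsum]
    exact tsum_congr fun x => by simp [mul_comm]
  have hsin : Summable fun x => φ (v x) * (y - z) x := by
    have := lp_summable_mul (superposition hφ v) (y - z)
    simp only [superposition_apply, ← abs_mul] at this
    exact this.of_abs
  dsimp only
  rw [hin, ← (hF.summable _).tsum_sub (hF.summable _),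
    ← ((hF.summable _).sub (hF.summable _)).tsum_sub hsin]
  have hs1 := (lp_summable_mul v (y - z)).mul_left ε
  have hs2 := (lp_summable_mul (y - v) (y - z)).mul_left K
  have hs3 := (lp_summable_mul (z - v) (y - z)).mul_left K
  have hbd : ‖∑' x, ((∫ t in (0 : ℝ)..y x, φ t) - (∫ t in (0 : ℝ)..z x, φ t)
      - φ (v x) * (y - z) x)‖ ≤ ∑' x, (ε * (|v x| * |(y - z) x|)
        + K * (|(y - v) x| * |(y - z) x|) + K * (|(z - v) x| * |(y - z) x|)) := by
    refine tsum_of_norm_bounded ((hs1.add hs2).add hs3).hasSum fun x => ?_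
    have hi : ∀ a b, IntervalIntegrable φ volume a b :=
      fun a b => hφ.continuous.intervalIntegrable a b
    have e0 : ∀ a b : ℓ², (a - b) x = a x - b x := fun a b => rfl
    have e1 : (∫ t in (0 : ℝ)..y x, φ t) - (∫ t in (0 : ℝ)..z x, φ t) - φ (v x) * (y - z) x
        = ∫ t in z x..y x, (φ t - φ (v x)) := by
      rw [intervalIntegral.integral_sub (hi _ _) (by simp),
        intervalIntegral.integral_interval_sub_left (hi _ _) (hi _ _),
        intervalIntegral.integral_const, e0, smul_eq_mul, mul_comm]
    rw [e1]
    have e2 := intervalIntegral.norm_integral_le_of_norm_le_const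
      (f := fun t => φ t - φ (v x)) (a := z x) (b := y x)
      (C := ε * |v x| + K * (|(y - v) x| + |(z - v) x|)) fun t ht => by
        have ht' : |t - v x| ≤ |(y - v) x| + |(z - v) x| := by
          rw [e0, e0]
          have ht := Set.uIoc_subset_uIcc ht
          rw [Set.mem_uIcc] at ht
          have a1 := abs_le.mp (le_refl |y x - v x|)
          have a2 := abs_le.mp (le_refl |z x - v x|)
          have a3 := abs_nonneg (y x - v x)
          have a4 := abs_nonneg (z x - v x)
          rw [abs_le]
          rcases ht with ht | ht <;> constructor <;> linarith [ht.1, ht.2]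
        have hyx := lp_abs_apply_le (y - v) x
        have hzx := lp_abs_apply_le (z - v) x
        have hvx := lp_abs_apply_le v x
        have := h (v x) (t - v x) (by linarith) (by linarith [norm_nonneg v])
        rw [add_sub_cancel, pow_one, pow_one] at this
        exact this.trans (by gcongr)
    refine e2.trans (le_of_eq ?_)
    rw [← e0]
    ring
  rw [(hs1.add hs2).tsum_add hs3, hs1.tsum_add hs2, tsum_mul_left, tsum_mul_left,
    tsum_mul_left] at hbd
  refine hbd.trans ?_
  have b1 : ε * ∑' x, |v x| * |(y - z) x| ≤ c / 2 * ‖y - z‖ := by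
    calc ε * ∑' x, |v x| * |(y - z) x| ≤ ε * ((‖v‖ + 1) * ‖y - z‖) := by
          gcongr
          refine (lp_tsum_mul_le v (y - z)).trans ?_
          gcongr
          linarith
      _ = c / 2 * ‖y - z‖ := by simp only [ε]; field_simp
  have b2 : ∀ a : ℓ², ‖a‖ < c / 4 / (K + 1) →
      K * ∑' x, |a x| * |(y - z) x| ≤ c / 4 * ‖y - z‖ := fun a ha => by
    calc K * ∑' x, |a x| * |(y - z) x| ≤ (K + 1) * (c / 4 / (K + 1) * ‖y - z‖) := by
          gcongr
          · linarith
          · refine (lp_tsum_mul_le a (y - z)).trans ?_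
            gcongr
      _ = c / 4 * ‖y - z‖ := by field_simp
  linarith [b2 _ hy2, b2 _ hz2]

end Superposition

/-! ### Autonomous nonlinearities -/

/-- The structural hypotheses on an autonomous nonlinearity `g`: `g u = o(u)` at `0`,
`g u / |u|` is strictly increasing on both half-lines, and the primitive is superquadratic. -/
structure Nonlinearity (g : ℝ → ℝ) : Prop where
  vanishes : VanishesToOrder 1 g
  strictMonoOn_neg : StrictMonoOn (fun u => g u / |u|) (Set.Iio 0)
  strictMonoOn_pos : StrictMonoOn (fun u => g u / |u|) (Set.Ioi 0)
  superquadratic : ∀ M : ℝ, ∃ R : ℝ, 0 < R ∧ ∀ u, R ≤ |u| → M ≤ (∫ t in (0 : ℝ)..u, g t) / u ^ 2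

/-- The integrand `g(u) u / 2 - ∫₀ᵘ g` of the energy on the Nehari manifold. -/
def excessDensity (g : ℝ → ℝ) (u : ℝ) : ℝ := 1 / 2 * (g u * u) - ∫ t in (0 : ℝ)..u, g t

namespace Nonlinearity

variable {g : ℝ → ℝ}

theorem mul_lt_of_lt_one (hg : Nonlinearity g) {t u : ℝ} (ht0 : 0 < t) (ht1 : t < 1)
    (hu : u ≠ 0) : g (t * u) * u < t * (g u * u) := by
  rcases lt_or_gt_of_ne hu with hu | hu
  · have htu : t * u < 0 := mul_neg_of_pos_of_neg ht0 hu
    have h := hg.strictMonoOn_neg (Set.mem_Iio.mpr hu) (Set.mem_Iio.mpr htu) (by nlinarith)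
    simp only [abs_of_neg hu, abs_of_neg htu] at h
    rw [div_lt_div_iff₀ (by linarith) (by linarith)] at h
    nlinarith
  · have htu : 0 < t * u := mul_pos ht0 hu
    have h := hg.strictMonoOn_pos (Set.mem_Ioi.mpr htu) (Set.mem_Ioi.mpr hu) (by nlinarith)
    simp only [abs_of_pos hu, abs_of_pos htu] at h
    rw [div_lt_div_iff₀ (by linarith) (by linarith)] at h
    nlinarith

theorem lt_mul_of_one_lt (hg : Nonlinearity g) {t u : ℝ} (ht1 : 1 < t) (hu : u ≠ 0) :
    t * (g u * u) < g (t * u) * u := by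
  have ht0 : 0 < t := by linarith
  have h := hg.mul_lt_of_lt_one (t := t⁻¹) (u := t * u) (by positivity)
    (inv_lt_one_of_one_lt₀ ht1) (by positivity)
  have e1 : t⁻¹ * (t * u) = u := by field_simp
  have e2 : t⁻¹ * (g (t * u) * (t * u)) = g (t * u) * u := by field_simp
  rw [e1, e2] at h
  linarith

theorem mul_le_of_le_one (hg : Nonlinearity g) {t : ℝ} (u : ℝ) (ht0 : 0 ≤ t) (ht1 : t ≤ 1) :
    g (t * u) * u ≤ t * (g u * u) := by
  rcases eq_or_ne u 0 with rfl | hu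
  · simp
  rcases ht0.eq_or_lt with rfl | ht0
  · simp [hg.vanishes.apply_zero one_ne_zero]
  rcases ht1.eq_or_lt with rfl | ht1
  · simp
  exact (hg.mul_lt_of_lt_one ht0 ht1 hu).le

theorem le_mul_of_one_le (hg : Nonlinearity g) {t : ℝ} (u : ℝ) (ht1 : 1 ≤ t) :
    t * (g u * u) ≤ g (t * u) * u := by
  rcases eq_or_ne u 0 with rfl | hu
  · simp
  rcases ht1.eq_or_lt with rfl | ht1
  · simp
  exact (hg.lt_mul_of_one_lt ht1 hu).le

theorem le_primitive_sub (hg : Nonlinearity g) {t : ℝ} (u : ℝ) (ht : 0 ≤ t) :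
    (t ^ 2 - 1) / 2 * (g u * u) ≤ (∫ s in (0 : ℝ)..t * u, g s) - ∫ s in (0 : ℝ)..u, g s := by
  set ψ : ℝ → ℝ := fun t => (∫ s in (0 : ℝ)..t * u, g s) - t ^ 2 / 2 * (g u * u)
  have hd : ∀ t, HasDerivAt ψ (g (t * u) * u - t * (g u * u)) t := fun t => by
    have h1 : HasDerivAt (fun v => ∫ s in (0 : ℝ)..v, g s) (g (t * u)) (t * u) :=
      intervalIntegral.integral_hasDerivAt_right
        (hg.vanishes.continuous.intervalIntegrable _ _)
        (hg.vanishes.continuous.stronglyMeasurableAtFilter _ _)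
        hg.vanishes.continuous.continuousAt
    have h2 : HasDerivAt (fun t : ℝ => t * u) u t := by simpa using (hasDerivAt_id t).mul_const u
    have h3 : HasDerivAt (fun t : ℝ => t ^ 2 / 2 * (g u * u)) (t * (g u * u)) t := by
      have h := (((hasDerivAt_pow 2 t).div_const 2).mul_const (g u * u))
      have e : ((2 : ℕ) : ℝ) * t ^ (2 - 1) / 2 * (g u * u) = t * (g u * u) := by
        push_cast
        ring
      rwa [e] at h
    exact (h1.comp t h2).sub h3
  have hc : Continuous ψ := continuous_iff_continuousAt.mpr fun t => (hd t).continuousAt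
  have key : ψ 1 ≤ ψ t := by
    rcases le_total t 1 with h1 | h1
    · refine antitoneOn_of_deriv_nonpos (convex_Icc 0 1) hc.continuousOn
        (fun s _ => (hd s).differentiableAt.differentiableWithinAt) (fun s hs => ?_)
        (Set.mem_Icc.mpr ⟨ht, h1⟩) (Set.mem_Icc.mpr ⟨zero_le_one, le_rfl⟩) h1
      rw [interior_Icc] at hs
      rw [(hd s).deriv]
      linarith [hg.mul_le_of_le_one u hs.1.le hs.2.le]
    · refine monotoneOn_of_deriv_nonneg (convex_Ici 1) hc.continuousOn
        (fun s _ => (hd s).differentiableAt.differentiableWithinAt) (fun s hs => ?_)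
        (Set.mem_Ici.mpr le_rfl) (Set.mem_Ici.mpr h1) h1
      rw [interior_Ici] at hs
      rw [(hd s).deriv]
      linarith [hg.le_mul_of_one_le u (Set.mem_Ioi.mp hs).le]
  simp only [ψ, one_mul] at key
  linarith

theorem mul_self_nonneg (hg : Nonlinearity g) (u : ℝ) : 0 ≤ g u * u := by
  rcases eq_or_ne u 0 with rfl | hu
  · simp
  refine le_of_forall_pos_le_add fun ε hε => ?_
  have hu2 : 0 < u ^ 2 := by positivity
  obtain ⟨δ, hδ, h⟩ := hg.vanishes.small (ε / u ^ 2) (by positivity)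
  set t := min (1 / 2) (δ / (2 * |u|)) with ht
  have hau : 0 < |u| := abs_pos.mpr hu
  have ht0 : 0 < t := lt_min (by norm_num) (by positivity)
  have ht1 : t < 1 := (min_le_left _ _).trans_lt (by norm_num)
  have h1 := hg.mul_lt_of_lt_one ht0 ht1 hu
  have htu : |t * u| < δ := by
    rw [abs_mul, abs_of_pos ht0]
    calc t * |u| ≤ δ / (2 * |u|) * |u| := by gcongr; exact min_le_right _ _
      _ = δ / 2 := by field_simp
      _ < δ := half_lt_self hδ
  have h2 := h _ htu
  rw [pow_one, abs_mul, abs_of_pos ht0] at h2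
  have h3 : |g (t * u) * u| ≤ t * ε := by
    rw [abs_mul]
    calc |g (t * u)| * |u| ≤ ε / u ^ 2 * (t * |u|) * |u| := by gcongr
      _ = t * ε := by rw [← sq_abs u]; field_simp
  have h4 := neg_abs_le (g (t * u) * u)
  have h5 : 0 < t * (g u * u + ε) := by linarith
  linarith [(pos_iff_pos_of_mul_pos h5).mp ht0]

theorem primitive_nonneg (hg : Nonlinearity g) (u : ℝ) : 0 ≤ ∫ t in (0 : ℝ)..u, g t := by
  rcases le_total 0 u with hu | hu
  · refine intervalIntegral.integral_nonneg hu fun t ht => ?_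
    rcases ht.1.eq_or_lt with h0 | h0
    · rw [← h0, hg.vanishes.apply_zero one_ne_zero]
    · exact nonneg_of_mul_nonneg_left (hg.mul_self_nonneg t) h0
  · rw [intervalIntegral.integral_symm, ← intervalIntegral.integral_neg]
    refine intervalIntegral.integral_nonneg hu fun t ht => ?_
    rcases ht.2.eq_or_lt with h0 | h0
    · rw [h0, hg.vanishes.apply_zero one_ne_zero, neg_zero]
    · nlinarith [hg.mul_self_nonneg t]

theorem vanishes_mul (hg : Nonlinearity g) : VanishesToOrder 2 fun u => g u * u :=
  hg.vanishes.mul_id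

theorem vanishes_primitive (hg : Nonlinearity g) :
    VanishesToOrder 2 fun u => ∫ t in (0 : ℝ)..u, g t :=
  hg.vanishes.primitive

theorem vanishes_excessDensity (hg : Nonlinearity g) : VanishesToOrder 2 (excessDensity g) :=
  (hg.vanishes_mul.const_mul (1 / 2)).sub hg.vanishes_primitive

theorem excessDensity_mul_le (hg : Nonlinearity g) {t : ℝ} (u : ℝ) (ht0 : 0 ≤ t)
    (ht1 : t ≤ 1) : excessDensity g (t * u) ≤ excessDensity g u := by
  have h1 := hg.le_primitive_sub u ht0
  have h2 := mul_le_mul_of_nonneg_left (hg.mul_le_of_le_one u ht0 ht1) ht0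
  simp only [excessDensity]
  nlinarith

theorem excessDensity_nonneg (hg : Nonlinearity g) (u : ℝ) : 0 ≤ excessDensity g u := by
  have h := hg.excessDensity_mul_le (t := 0) u le_rfl zero_le_one
  simpa [excessDensity] using h

theorem excessDensity_pos (hg : Nonlinearity g) {u : ℝ} (hu : u ≠ 0) :
    0 < excessDensity g u := by
  have h0 := hg.excessDensity_nonneg (1 / 2 * u)
  have h1 := hg.le_primitive_sub (t := 1 / 2) u (by norm_num)
  have h2 := hg.mul_lt_of_lt_one (t := 1 / 2) (by norm_num) (by norm_num) hu
  simp only [excessDensity] at h0 ⊢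
  nlinarith

end Nonlinearity

/-! ### Ground states for energies on Hilbert spaces isomorphic to `ℓ²` -/

section Variational

variable {ι : Type*} {H : Type*} [NormedAddCommGroup H] [InnerProductSpace ℝ H]
  (T : H ≃L[ℝ] lp (fun _ : ι => ℝ) 2) (g : ℝ → ℝ)

/-- The energy `‖u‖² / 2 - ∑ₓ ∫₀^{u(x)} g`, where `u(x)` are the coordinates given by `T`. -/
def coordEnergy (u : H) : ℝ := 1 / 2 * ‖u‖ ^ 2 - ∑' x, ∫ t in (0 : ℝ)..T u x, g t

/-- The derivative of the energy at `u` in direction `u`. -/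
def nehariForm (u : H) : ℝ := ‖u‖ ^ 2 - ∑' x, g (T u x) * T u x

/-- The value of the energy on the Nehari manifold. -/
def excess (u : H) : ℝ := ∑' x, excessDensity g (T u x)

variable {T g}

theorem map_smul_apply (t : ℝ) (u : H) (x : ι) : T (t • u) x = t * T u x := by
  rw [map_smul]
  rfl

theorem exists_coord_ne_zero {u : H} (hu : u ≠ 0) : ∃ x, T u x ≠ 0 := by
  by_contra! h
  refine hu (T.injective ?_)
  rw [map_zero]
  exact lp.ext (funext h)

/-- Superposition functionals are small compared with the norm where all coordinates are
small. -/
theorem VanishesToOrder.tsum_le_of_forall_lt {φ : ℝ → ℝ}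
    (hφ : VanishesToOrder 2 φ) : ∃ δ : ℝ, 0 < δ ∧ ∀ u : H, (∀ x, |T u x| < δ) →
      ∑' x, φ (T u x) ≤ 1 / 4 * ‖u‖ ^ 2 := by
  set C := ‖(T : H →L[ℝ] lp (fun _ : ι => ℝ) 2)‖ + 1
  have hC : 0 < C := by positivity
  obtain ⟨δ, hδ, h⟩ := hφ.small (1 / (4 * C ^ 2)) (by positivity)
  refine ⟨δ, hδ, fun u hu => ?_⟩
  have h1 : ‖T u‖ ≤ C * ‖u‖ :=
    ((T : H →L[ℝ] lp (fun _ : ι => ℝ) 2).le_opNorm u).trans (by gcongr; simp [C])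
  calc ∑' x, φ (T u x) ≤ ∑' x, 1 / (4 * C ^ 2) * T u x ^ 2 := by
        refine (hφ.summable (T u)).tsum_le_tsum (fun x => ?_) ((lp_summable_sq (T u)).mul_left _)
        simpa using (le_abs_self _).trans (h _ (hu x))
    _ = 1 / (4 * C ^ 2) * ‖T u‖ ^ 2 := by rw [tsum_mul_left, lp_norm_sq]
    _ ≤ 1 / (4 * C ^ 2) * (C * ‖u‖) ^ 2 := by gcongr
    _ = 1 / 4 * ‖u‖ ^ 2 := by field_simp

namespace Nonlinearity

theorem hasStrictFDerivAt_coordEnergy (hg : Nonlinearity g) (u : H) :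
    HasStrictFDerivAt (coordEnergy T g)
      (innerSL ℝ u - (innerSL ℝ (superposition hg.vanishes (T u))).comp
        (T : H →L[ℝ] lp (fun _ : ι => ℝ) 2)) u := by
  have h1 : HasStrictFDerivAt (fun u : H => 1 / 2 * ‖u‖ ^ 2) (innerSL ℝ u) u := by
    have h := (hasStrictFDerivAt_norm_sq u).const_mul (1 / 2 : ℝ)
    have e : (1 / 2 : ℝ) • (2 : ℕ) • innerSL ℝ u = innerSL ℝ u := by
      rw [← Nat.cast_smul_eq_nsmul ℝ, smul_smul]
      norm_num
    exact e ▸ h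
  exact h1.sub ((hg.vanishes.hasStrictFDerivAt_tsum_primitive (T u)).comp u
    T.hasStrictFDerivAt)

theorem fderiv_coordEnergy_self (hg : Nonlinearity g) (u : H) :
    fderiv ℝ (coordEnergy T g) u u = nehariForm T g u := by
  rw [(hg.hasStrictFDerivAt_coordEnergy u).hasFDerivAt.fderiv]
  simp only [nehariForm, sub_apply, innerSL_apply_apply,
    real_inner_self_eq_norm_sq, ContinuousLinearMap.comp_apply, lp.inner_eq_tsum,
    ContinuousLinearEquiv.coe_coe]
  congr 1
  exact tsum_congr fun x => by simp [mul_comm]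

theorem coordEnergy_eq (hg : Nonlinearity g) (u : H) :
    coordEnergy T g u = 1 / 2 * nehariForm T g u + excess T g u := by
  simp only [coordEnergy, nehariForm, excess, excessDensity]
  rw [((hg.vanishes_mul.summable (T u)).mul_left (1 / 2)).tsum_sub
    (hg.vanishes_primitive.summable (T u)), tsum_mul_left]
  ring

theorem continuous_nehariForm (hg : Nonlinearity g) : Continuous (nehariForm T g) :=
  (continuous_norm.pow 2).sub (hg.vanishes_mul.continuous_tsum.comp T.continuous)

theorem excess_nonneg (hg : Nonlinearity g) (u : H) : 0 ≤ excess T g u :=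
  tsum_nonneg fun _ => hg.excessDensity_nonneg _

theorem excess_pos (hg : Nonlinearity g) {u : H} (hu : u ≠ 0) : 0 < excess T g u := by
  obtain ⟨x, hx⟩ := exists_coord_ne_zero (T := T) hu
  exact (hg.vanishes_excessDensity.summable (T u)).tsum_pos
    (fun _ => hg.excessDensity_nonneg _) x (hg.excessDensity_pos hx)

theorem excess_smul_le (hg : Nonlinearity g) (u : H) {t : ℝ} (ht0 : 0 ≤ t) (ht1 : t ≤ 1) :
    excess T g (t • u) ≤ excess T g u := by
  refine (hg.vanishes_excessDensity.summable (T (t • u))).tsum_le_tsum (fun x => ?_)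
    (hg.vanishes_excessDensity.summable (T u))
  rw [map_smul_apply]
  exact hg.excessDensity_mul_le _ ht0 ht1

theorem nehariForm_smul (hg : Nonlinearity g) {u : H} (hD : nehariForm T g u = 0) (t : ℝ) :
    nehariForm T g (t • u)
      = ∑' x, (t ^ 2 * (g (T u x) * T u x) - t * (g (t * T u x) * T u x)) := by
  have h1 : Summable fun x => t * (g (t * T u x) * T u x) := by
    refine (hg.vanishes_mul.summable (T (t • u))).congr fun x => ?_
    rw [map_smul_apply]
    ring
  rw [((hg.vanishes_mul.summable (T u)).mul_left (t ^ 2)).tsum_sub h1, tsum_mul_left]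
  simp only [nehariForm] at hD ⊢
  rw [norm_smul, mul_pow, Real.norm_eq_abs, sq_abs, sub_eq_zero.mp hD]
  congr 1
  refine tsum_congr fun x => ?_
  rw [map_smul_apply]
  ring

theorem summable_nehariForm_smul (hg : Nonlinearity g) (u : H) (t : ℝ) :
    Summable fun x => t ^ 2 * (g (T u x) * T u x) - t * (g (t * T u x) * T u x) := by
  refine ((hg.vanishes_mul.summable (T u)).mul_left (t ^ 2)).sub
    ((hg.vanishes_mul.summable (T (t • u))).congr fun x => ?_)
  rw [map_smul_apply]
  ring

theorem nehariForm_smul_pos (hg : Nonlinearity g) {u : H} (hu : u ≠ 0)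
    (hD : nehariForm T g u = 0) {t : ℝ}
    (ht0 : 0 < t) (ht1 : t < 1) : 0 < nehariForm T g (t • u) := by
  obtain ⟨x, hx⟩ := exists_coord_ne_zero (T := T) hu
  rw [hg.nehariForm_smul hD]
  refine (hg.summable_nehariForm_smul u t).tsum_pos (fun y => ?_) x ?_
  · nlinarith [mul_le_mul_of_nonneg_left (hg.mul_le_of_le_one (T u y) ht0.le ht1.le) ht0.le]
  · nlinarith [mul_lt_mul_of_pos_left (hg.mul_lt_of_lt_one ht0 ht1 hx) ht0]

theorem nehariForm_smul_neg (hg : Nonlinearity g) {u : H} (hu : u ≠ 0)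
    (hD : nehariForm T g u = 0) {t : ℝ}
    (ht1 : 1 < t) : nehariForm T g (t • u) < 0 := by
  obtain ⟨x, hx⟩ := exists_coord_ne_zero (T := T) hu
  have ht0 : 0 < t := by linarith
  rw [hg.nehariForm_smul hD, ← neg_pos, ← tsum_neg]
  refine (hg.summable_nehariForm_smul u t).neg.tsum_pos (fun y => ?_) x ?_
  · nlinarith [mul_le_mul_of_nonneg_left (hg.le_mul_of_one_le (T u y) ht1.le) ht0.le]
  · nlinarith [mul_lt_mul_of_pos_left (hg.lt_mul_of_one_lt ht1 hx) ht0]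

/-- On the Nehari manifold, the energy is maximal along rays. -/
theorem coordEnergy_smul_le (hg : Nonlinearity g) {u : H} (hD : nehariForm T g u = 0)
    {t : ℝ} (ht : 0 ≤ t) : coordEnergy T g (t • u) ≤ coordEnergy T g u := by
  have h1 := (hg.vanishes_mul.summable (T u)).mul_left ((t ^ 2 - 1) / 2)
  have h2 := hg.vanishes_primitive.summable (T u)
  have h3 : Summable fun x => ∫ s in (0 : ℝ)..t * T u x, g s :=
    (hg.vanishes_primitive.summable (T (t • u))).congr fun x => by rw [map_smul_apply]
  have h4 := h1.tsum_le_tsum (fun x => hg.le_primitive_sub (T u x) ht) (h3.sub h2)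
  rw [h3.tsum_sub h2, tsum_mul_left] at h4
  simp only [nehariForm] at hD
  simp only [coordEnergy, map_smul_apply]
  rw [norm_smul, mul_pow, Real.norm_eq_abs, sq_abs, sub_eq_zero.mp hD]
  nlinarith

theorem nehariForm_pos_of_forall_lt (hg : Nonlinearity g) : ∃ δ : ℝ, 0 < δ ∧ ∀ u : H, u ≠ 0 →
    (∀ x, |T u x| < δ) → 0 < nehariForm T g u := by
  obtain ⟨δ, hδ, h⟩ := hg.vanishes_mul.tsum_le_of_forall_lt (T := T)
  refine ⟨δ, hδ, fun u hu hx => ?_⟩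
  have h1 := h u hx
  have h2 : 0 < ‖u‖ ^ 2 := by positivity
  simp only [nehariForm]
  linarith

theorem exists_smul_nehariForm_eq_zero (hg : Nonlinearity g) {u : H} (hu : u ≠ 0)
    (hD : nehariForm T g u ≤ 0) :
    ∃ t : ℝ, 0 < t ∧ t ≤ 1 ∧ nehariForm T g (t • u) = 0 := by
  obtain ⟨δ, hδ, h⟩ := hg.nehariForm_pos_of_forall_lt (T := T)
  set s := min 1 (δ / (2 * (‖T u‖ + 1)))
  have hs0 : 0 < s := lt_min one_pos (by positivity)
  have hs : 0 < nehariForm T g (s • u) := by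
    refine h _ (smul_ne_zero hs0.ne' hu) fun x => ?_
    rw [map_smul_apply, abs_mul, abs_of_pos hs0]
    calc s * |T u x| ≤ δ / (2 * (‖T u‖ + 1)) * (‖T u‖ + 1) := by
          gcongr
          · exact min_le_right _ _
          · linarith [lp_abs_apply_le (T u) x]
      _ = δ / 2 := by field_simp
      _ < δ := half_lt_self hδ
  have hc : Continuous fun t : ℝ => nehariForm T g (t • u) :=
    hg.continuous_nehariForm.comp (continuous_id.smul continuous_const)
  obtain ⟨t, ht, ht'⟩ := intermediate_value_Icc' (min_le_left 1 _ : s ≤ 1) hc.continuousOn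
    (show (0 : ℝ) ∈ Set.Icc _ _ from ⟨by simpa using hD, hs.le⟩)
  exact ⟨t, hs0.trans_le ht.1, ht.2, ht'⟩

theorem exists_nehariForm_eq_zero (hg : Nonlinearity g) [Nonempty ι] :
    ∃ u : H, u ≠ 0 ∧ nehariForm T g u = 0 := by
  classical
  obtain ⟨o⟩ := ‹Nonempty ι›
  set w : H := T.symm (lp.single 2 o (1 : ℝ))
  have hTw : T w = lp.single 2 o (1 : ℝ) := T.apply_symm_apply _
  obtain ⟨t, ht, h⟩ := hg.superquadratic (‖w‖ ^ 2)
  have h1 := h t (le_abs_self t)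
  rw [le_div_iff₀ (by positivity)] at h1
  have h2 := hg.excessDensity_nonneg t
  have h3 := hg.primitive_nonneg t
  simp only [excessDensity] at h2
  have hx : ∀ x, T (t • w) x = if x = o then t else 0 := fun x => by
    rw [map_smul_apply, hTw]
    split_ifs with hxo
    · subst hxo; simp
    · simp [hxo]
  have hD : nehariForm T g (t • w) ≤ 0 := by
    have : ∑' x, g (T (t • w) x) * T (t • w) x = g t * t := by
      simp_rw [hx]
      rw [tsum_eq_single o fun x hxo => by simp [hxo]]
      simp
    simp only [nehariForm]
    rw [this, norm_smul, mul_pow, Real.norm_eq_abs, sq_abs]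
    nlinarith
  have hne : t • w ≠ 0 := fun h0 => by
    have := hx o
    rw [h0, map_zero] at this
    simp at this
    exact ht.ne this
  obtain ⟨s, hs, -, hs'⟩ := hg.exists_smul_nehariForm_eq_zero hne hD
  exact ⟨_, smul_ne_zero hs.ne' hne, hs'⟩

theorem coordEnergy_eq_excess (hg : Nonlinearity g) {u : H} (hD : nehariForm T g u = 0) :
    coordEnergy T g u = excess T g u := by
  rw [hg.coordEnergy_eq, hD]
  ring

/-- Sublevel sets of the energy on the Nehari manifold are bounded. -/
theorem exists_norm_le_of_coordEnergy_le (hg : Nonlinearity g) (C : ℝ) : ∃ R : ℝ, ∀ u : H, u ≠ 0 →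
    nehariForm T g u = 0 → coordEnergy T g u ≤ C → ‖u‖ ≤ R := by
  obtain ⟨δ, hδ, h⟩ := hg.vanishes_primitive.tsum_le_of_forall_lt (T := T)
  set s := 2 * (|C| + 1)
  have hs : 0 < s := by positivity
  have hsC : C < 1 / 4 * s ^ 2 := by
    have := le_abs_self C
    have := abs_nonneg C
    simp only [s]
    nlinarith
  obtain ⟨R, hR, hsup⟩ := hg.superquadratic (1 / (δ / s) ^ 2)
  refine ⟨R / (δ / s), fun u hu hD hC => ?_⟩
  have hu0 : 0 < ‖u‖ := norm_pos_iff.mpr hu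
  have hr : 0 < s / ‖u‖ := by positivity
  obtain ⟨x, hx⟩ : ∃ x, δ / s * ‖u‖ ≤ |T u x| := by
    by_contra! hlt
    have h1 := h ((s / ‖u‖) • u) fun x => by
      rw [map_smul_apply, abs_mul, abs_of_pos hr]
      calc s / ‖u‖ * |T u x| < s / ‖u‖ * (δ / s * ‖u‖) := by gcongr; exact hlt x
        _ = δ := by field_simp
    have h2 := hg.coordEnergy_smul_le hD hr.le
    have h3 : ‖(s / ‖u‖) • u‖ = s := by
      rw [norm_smul, Real.norm_of_nonneg hr.le]
      field_simp
    rw [h3] at h1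
    rw [coordEnergy, h3] at h2
    linarith
  by_contra! hlt
  rw [div_lt_iff₀ (by positivity)] at hlt
  have h1 := hsup (T u x) (by linarith [mul_comm ‖u‖ (δ / s)])
  have hTpos : 0 < |T u x| := (by positivity : 0 < δ / s * ‖u‖).trans_le hx
  have hTsq : (δ / s * ‖u‖) ^ 2 ≤ T u x ^ 2 := by
    rw [← sq_abs (T u x)]
    gcongr
  rw [le_div_iff₀ (by rw [← sq_abs]; positivity)] at h1
  have h2 : ‖u‖ ^ 2 ≤ ∫ t in (0 : ℝ)..T u x, g t := by
    calc ‖u‖ ^ 2 = 1 / (δ / s) ^ 2 * (δ / s * ‖u‖) ^ 2 := by field_simp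
      _ ≤ 1 / (δ / s) ^ 2 * T u x ^ 2 := by gcongr
      _ ≤ _ := h1
  have h3 : (∫ t in (0 : ℝ)..T u x, g t) ≤ ∑' y, ∫ t in (0 : ℝ)..T u y, g t :=
    (hg.vanishes_primitive.summable (T u)).le_tsum x fun y _ => hg.primitive_nonneg _
  have h4 := hg.excess_nonneg (T := T) u
  rw [← hg.coordEnergy_eq_excess hD, coordEnergy] at h4
  have : 0 < ‖u‖ ^ 2 := by positivity
  linarith

/-- A minimizer of the energy on the Nehari manifold is a critical point of the energy. -/
theorem hasFDerivAt_zero_of_minimizer (hg : Nonlinearity g) {u : H} (hu : u ≠ 0)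
    (hD : nehariForm T g u = 0)
    (hmin : ∀ w : H, w ≠ 0 → nehariForm T g w = 0 → coordEnergy T g u ≤ coordEnergy T g w) :
    HasFDerivAt (coordEnergy T g) (0 : H →L[ℝ] ℝ) u := by
  have hst := hg.hasStrictFDerivAt_coordEnergy (T := T) u
  set L := innerSL ℝ u - (innerSL ℝ (superposition hg.vanishes (T u))).comp
        (T : H →L[ℝ] lp (fun _ : ι => ℝ) 2)
  suffices hL : L = 0 from hL ▸ hst.hasFDerivAt
  by_contra hL
  obtain ⟨v, hv⟩ : ∃ v, L v < 0 := by
    obtain ⟨v, hv⟩ : ∃ v, L v ≠ 0 := by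
      by_contra! h
      exact hL (ContinuousLinearMap.ext h)
    rcases lt_or_gt_of_ne hv with h | h
    · exact ⟨v, h⟩
    · exact ⟨-v, by rw [map_neg]; linarith⟩
  have hlo := hst.isLittleO
  rw [Asymptotics.isLittleO_iff] at hlo
  have hc : 0 < -L v / (2 * (‖v‖ + 1)) := by
    have : 0 < -L v := by linarith
    positivity
  obtain ⟨r, hr, hball⟩ := Metric.eventually_nhds_iff.mp (hlo hc)
  set Y : ℝ × ℝ → H := fun p => p.1 • (u + p.2 • v)
  have hY : Continuous Y := by fun_prop
  have hY0 : Y (1, 0) = u := by simp [Y]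
  obtain ⟨ε₀, hε₀, hYr⟩ := Metric.continuous_iff.mp hY (1, 0) r hr
  set ε := min (ε₀ / 2) (1 / 2)
  have hε : 0 < ε := lt_min (by positivity) (by norm_num)
  have hεε₀ : ε < ε₀ := (min_le_left _ _).trans_lt (half_lt_self hε₀)
  have hε1 : ε < 1 := (min_le_right _ _).trans_lt (by norm_num)
  have hDY : ∀ t : ℝ, Continuous fun s : ℝ => nehariForm T g (Y (t, s)) := fun t =>
    hg.continuous_nehariForm.comp (hY.comp (by fun_prop))
  have hp : 0 < nehariForm T g (Y (1 - ε, 0)) := by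
    simpa [Y] using hg.nehariForm_smul_pos hu hD (t := 1 - ε) (by linarith) (by linarith)
  have hn : nehariForm T g (Y (1 + ε, 0)) < 0 := by
    simpa [Y] using hg.nehariForm_smul_neg hu hD (t := 1 + ε) (by linarith)
  have hne : ∀ᶠ s : ℝ in 𝓝 0, u + s • v ≠ 0 := by
    have : Tendsto (fun s : ℝ => u + s • v) (𝓝 0) (𝓝 (u + (0 : ℝ) • v)) :=
      Continuous.tendsto (by fun_prop) 0
    exact this.eventually_ne (by simpa using hu)
  have hs : ∀ᶠ s : ℝ in 𝓝[>] 0, u + s • v ≠ 0 ∧ 0 < nehariForm T g (Y (1 - ε, s)) ∧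
      nehariForm T g (Y (1 + ε, s)) < 0 ∧ |s| < ε ∧ 0 < s := by
    have e1 := ((hDY (1 - ε)).tendsto 0).eventually_const_lt hp
    have e2 := ((hDY (1 + ε)).tendsto 0).eventually_lt_const hn
    have e3 : ∀ᶠ s : ℝ in 𝓝 0, |s| < ε :=
      (continuous_abs.tendsto (0 : ℝ)).eventually_lt_const (by simpa using hε)
    filter_upwards [nhdsWithin_le_nhds hne, nhdsWithin_le_nhds e1, nhdsWithin_le_nhds e2,
      nhdsWithin_le_nhds e3, self_mem_nhdsWithin] with s a b c d e
    exact ⟨a, b, c, d, e⟩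
  obtain ⟨s, hsne, hsp, hsn, hsε, hs0⟩ := hs.exists
  have hct : Continuous fun t : ℝ => nehariForm T g (Y (t, s)) :=
    hg.continuous_nehariForm.comp (hY.comp (by fun_prop))
  obtain ⟨t, ht, ht0⟩ := intermediate_value_Icc' (by linarith : 1 - ε ≤ 1 + ε) hct.continuousOn
    (show (0 : ℝ) ∈ Set.Icc _ _ from ⟨hsn.le, hsp.le⟩)
  have htpos : 0 < t := by linarith [ht.1]
  have hdist : ∀ s' : ℝ, |s'| < ε → dist (Y (t, s')) u < r := fun s' hs' => by
    rw [← hY0]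
    refine hYr _ ?_
    rw [Prod.dist_eq, max_lt_iff]
    simp only [Real.dist_eq, sub_zero]
    refine ⟨?_, hs'.trans hεε₀⟩
    rw [abs_lt]
    constructor <;> linarith [ht.1, ht.2]
  have hb := @hball (Y (t, s), Y (t, 0)) (by
    rw [Prod.dist_eq]
    exact max_lt (hdist s hsε) (hdist 0 (by simpa using hε)))
  have hsub : Y (t, s) - Y (t, 0) = (t * s) • v := by
    simp only [Y, zero_smul, add_zero]
    rw [smul_add, smul_smul, add_sub_cancel_left]
  simp only [hsub, map_smul, smul_eq_mul, norm_smul, Real.norm_eq_abs, abs_mul,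
    abs_of_pos htpos, abs_of_pos hs0] at hb
  have h1 := hmin (Y (t, s)) (smul_ne_zero htpos.ne' hsne) ht0
  have h2 : coordEnergy T g (Y (t, 0)) ≤ coordEnergy T g u := by
    simpa [Y] using hg.coordEnergy_smul_le hD htpos.le
  have h3 := (abs_le.mp hb).2
  have hts : 0 < t * s := mul_pos htpos hs0
  have h4 : -L v / (2 * (‖v‖ + 1)) * (t * s * ‖v‖) ≤ t * s * (-L v / 2) := by
    calc -L v / (2 * (‖v‖ + 1)) * (t * s * ‖v‖)
        ≤ -L v / (2 * (‖v‖ + 1)) * (t * s * (‖v‖ + 1)) := by gcongr; linarith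
      _ = t * s * (-L v / 2) := by field_simp
  have h5 : 0 < t * s * (-L v / 2) := mul_pos hts (by linarith)
  linarith

/-- The Nehari form and the excess split along `u + wₙ`, where `wₙ` is bounded and tends to zero
in every coordinate. -/
theorem tendsto_nehariForm_add_sub (hg : Nonlinearity g) (u : H) {w : ℕ → H} {B : ℝ}
    (hB : ∀ n, ‖T (w n)‖ ≤ B)
    (hw : ∀ x, Tendsto (fun n => T (w n) x) atTop (𝓝 0)) :
    Tendsto (fun n => nehariForm T g (u + w n) - nehariForm T g (w n)) atTop
      (𝓝 (nehariForm T g u)) := by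
  have h1 := hg.vanishes_mul.tendsto_tsum_add_sub (T u) hB hw
  have h2 := lp_tendsto_dual_zero hB hw
    ((innerSL ℝ u).comp (T.symm : lp (fun _ : ι => ℝ) 2 →L[ℝ] H))
  have h3 := ((h2.const_mul 2).const_add (‖u‖ ^ 2)).sub h1
  simp only [mul_zero, add_zero] at h3
  refine h3.congr fun n => ?_
  simp only [nehariForm, map_add, norm_add_sq_real, ContinuousLinearMap.comp_apply,
    ContinuousLinearEquiv.coe_coe, ContinuousLinearEquiv.symm_apply_apply, innerSL_apply_apply]
  ring

theorem tendsto_excess_add_sub (hg : Nonlinearity g) (u : H) {w : ℕ → H} {B : ℝ}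
    (hB : ∀ n, ‖T (w n)‖ ≤ B)
    (hw : ∀ x, Tendsto (fun n => T (w n) x) atTop (𝓝 0)) :
    Tendsto (fun n => excess T g (u + w n) - excess T g (w n)) atTop (𝓝 (excess T g u)) := by
  simpa only [excess, map_add] using
    hg.vanishes_excessDensity.tendsto_tsum_add_sub (T u) hB hw

/-- The energy attains its infimum over the Nehari manifold, if it is invariant under a
transitive family of permutations of the coordinates. -/
theorem exists_minimizer (hg : Nonlinearity g) [Countable ι] (o : ι)
    (htr : ∀ (y : ι) (u : H), ∃ u' : H, ‖u'‖ = ‖u‖ ∧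
      ∃ σ : Equiv.Perm ι, σ o = y ∧ ∀ x, T u' x = T u (σ x)) :
    ∃ u : H, u ≠ 0 ∧ nehariForm T g u = 0 ∧
      ∀ w : H, w ≠ 0 → nehariForm T g w = 0 → coordEnergy T g u ≤ coordEnergy T g w := by
  have : Nonempty ι := ⟨o⟩
  set M : Set H := {u | u ≠ 0 ∧ nehariForm T g u = 0}
  have hMne : (coordEnergy T g '' M).Nonempty := by
    obtain ⟨u, hu⟩ := hg.exists_nehariForm_eq_zero (T := T)
    exact ⟨_, u, hu, rfl⟩
  have hMbdd : BddBelow (coordEnergy T g '' M) := by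
    refine ⟨0, ?_⟩
    rintro _ ⟨u, hu, rfl⟩
    rw [hg.coordEnergy_eq_excess hu.2]
    exact hg.excess_nonneg u
  set c := sInf (coordEnergy T g '' M)
  have hcle : ∀ w : H, w ≠ 0 → nehariForm T g w = 0 → c ≤ excess T g w := fun w hw hD => by
    rw [← hg.coordEnergy_eq_excess hD]
    exact csInf_le hMbdd ⟨w, ⟨hw, hD⟩, rfl⟩
  obtain ⟨e, he, hec, heM⟩ := exists_seq_tendsto_sInf hMne hMbdd
  choose u₀ hu₀ hu₀e using heM
  obtain ⟨δ, hδ, hnv⟩ := hg.nehariForm_pos_of_forall_lt (T := T)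
  have hex : ∀ n, ∃ u : H, u ≠ 0 ∧ nehariForm T g u = 0 ∧ coordEnergy T g u = e n ∧
      δ ≤ |T u o| := fun n => by
    obtain ⟨y, hy⟩ : ∃ y, δ ≤ |T (u₀ n) y| := by
      by_contra! h
      exact (hnv _ (hu₀ n).1 h).ne' (hu₀ n).2
    obtain ⟨u', hn, σ, hσ, hx⟩ := htr y (u₀ n)
    have hsum : ∀ φ : ℝ → ℝ, ∑' x, φ (T u' x) = ∑' x, φ (T (u₀ n) x) := fun φ => by
      simp_rw [hx]
      exact σ.tsum_eq fun x => φ (T (u₀ n) x)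
    refine ⟨u', ?_, ?_, ?_, ?_⟩
    · rw [← norm_ne_zero_iff, hn, norm_ne_zero_iff]
      exact (hu₀ n).1
    · rw [← (hu₀ n).2]
      simp only [nehariForm, hn]
      congr 1
      exact hsum fun t => g t * t
    · rw [← hu₀e n]
      simp only [coordEnergy, hn]
      congr 1
      exact hsum fun t => ∫ s in (0 : ℝ)..t, g s
    · rw [hx, hσ]
      exact hy
  choose u₁ hu₁ hDu₁ hEu₁ hδu₁ using hex
  obtain ⟨R, hR⟩ := hg.exists_norm_le_of_coordEnergy_le (T := T) (e 0)
  have hR1 : ∀ n, ‖u₁ n‖ ≤ R := fun n =>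
    hR _ (hu₁ n) (hDu₁ n) ((hEu₁ n).le.trans (he (Nat.zero_le n)))
  obtain ⟨B, hB⟩ : ∃ B, ∀ n, ‖T (u₁ n)‖ ≤ B :=
    ⟨‖(T : H →L[ℝ] lp (fun _ : ι => ℝ) 2)‖ * R, fun n =>
      ((T : H →L[ℝ] lp (fun _ : ι => ℝ) 2).le_opNorm _).trans (by gcongr; exact hR1 n)⟩
  obtain ⟨a, -, k, hk, hka⟩ := (isCompact_univ_pi fun _ : ι => isCompact_Icc (a := -B)
    (b := B)).tendsto_subseq (x := fun n => (T (u₁ n) : ι → ℝ)) fun n x _ =>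
      abs_le.mp ((lp_abs_apply_le _ x).trans (hB n))
  have hamem : Memℓp a 2 := lp.memℓp_of_tendsto (F := fun n => T (u₁ (k n)))
    (l := atTop) (isBounded_iff_forall_norm_le.mpr ⟨B, by rintro _ ⟨n, rfl⟩; exact hB _⟩) hka
  set u : H := T.symm ⟨a, hamem⟩
  have hTu : ∀ x, T u x = a x := fun x => by
    rw [show T u = ⟨a, hamem⟩ from T.apply_symm_apply _]
  have hpt : ∀ x, Tendsto (fun n => T (u₁ (k n)) x) atTop (𝓝 (T u x)) := fun x => by
    rw [hTu]
    exact tendsto_pi_nhds.mp hka x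
  have hu : u ≠ 0 := fun h0 => by
    have h1 : δ ≤ |T u o| := ge_of_tendsto' (hpt o).abs fun n => hδu₁ _
    rw [h0, map_zero] at h1
    simp at h1
    linarith
  set w : ℕ → H := fun n => u₁ (k n) - u
  have huw : ∀ n, u + w n = u₁ (k n) := fun n => add_sub_cancel _ _
  have hwB : ∀ n, ‖T (w n)‖ ≤ B + ‖T u‖ := fun n => by
    rw [map_sub]
    exact (norm_sub_le _ _).trans (by gcongr; exact hB _)
  have hw0 : ∀ x, Tendsto (fun n => T (w n) x) atTop (𝓝 0) := fun x => by
    have := (hpt x).sub_const (T u x)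
    rw [sub_self] at this
    refine this.congr fun n => ?_
    rw [map_sub]
    rfl
  have hD := hg.tendsto_nehariForm_add_sub u hwB hw0
  have hG := hg.tendsto_excess_add_sub u hwB hw0
  have hGc : Tendsto (fun n => excess T g (u + w n)) atTop (𝓝 c) := by
    refine (hec.comp hk.tendsto_atTop).congr fun n => ?_
    rw [huw, ← hg.coordEnergy_eq_excess (hDu₁ _), hEu₁]
    rfl
  have hGw : Tendsto (fun n => excess T g (w n)) atTop (𝓝 (c - excess T g u)) :=
    (hGc.sub hG).congr fun n => by ring
  rcases le_or_gt (nehariForm T g u) 0 with hDu | hDu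
  · obtain ⟨t, ht0, ht1, ht⟩ := hg.exists_smul_nehariForm_eq_zero hu hDu
    refine ⟨t • u, smul_ne_zero ht0.ne' hu, ht, fun v hv hDv => ?_⟩
    rw [hg.coordEnergy_eq_excess ht, hg.coordEnergy_eq_excess hDv]
    have h1 := hg.excess_smul_le (T := T) u ht0.le ht1
    have h2 : 0 ≤ c - excess T g u := ge_of_tendsto' hGw fun n => hg.excess_nonneg _
    linarith [hcle v hv hDv]
  · exfalso
    have h1 : ∀ᶠ n in atTop, nehariForm T g (w n) < 0 := by
      filter_upwards [hD.eventually_const_lt hDu] with n hn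
      rw [huw, hDu₁] at hn
      linarith
    have h2 : ∀ᶠ n in atTop, excess T g (w n) < c :=
      hGw.eventually_lt_const (by linarith [hg.excess_pos (T := T) hu])
    obtain ⟨n, hn1, hn2⟩ := (h1.and h2).exists
    have hwn : w n ≠ 0 := fun h0 => by
      rw [h0] at hn1
      simp [nehariForm] at hn1
    obtain ⟨t, ht0, ht1, ht⟩ := hg.exists_smul_nehariForm_eq_zero hwn hn1.le
    have h3 := hcle _ (smul_ne_zero ht0.ne' hwn) ht
    have h4 := hg.excess_smul_le (T := T) (w n) ht0.le ht1
    linarith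

/-- Existence of a ground state. -/
theorem exists_groundState (hg : Nonlinearity g) [Countable ι] (o : ι)
    (htr : ∀ (y : ι) (u : H), ∃ u' : H, ‖u'‖ = ‖u‖ ∧
      ∃ σ : Equiv.Perm ι, σ o = y ∧ ∀ x, T u' x = T u (σ x)) :
    ∃ u : H, u ≠ 0 ∧ HasFDerivAt (coordEnergy T g) (0 : H →L[ℝ] ℝ) u ∧
      IsGLB (coordEnergy T g '' {u | u ≠ 0 ∧ fderiv ℝ (coordEnergy T g) u u = 0})
        (coordEnergy T g u) ∧ 0 < coordEnergy T g u := by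
  obtain ⟨u, hu, hD, hmin⟩ := hg.exists_minimizer o htr
  refine ⟨u, hu, hg.hasFDerivAt_zero_of_minimizer hu hD hmin, IsLeast.isGLB ⟨?_, ?_⟩, ?_⟩
  · exact ⟨u, ⟨hu, by rw [hg.fderiv_coordEnergy_self, hD]⟩, rfl⟩
  · rintro _ ⟨w, ⟨hw, hDw⟩, rfl⟩
    rw [hg.fderiv_coordEnergy_self] at hDw
    exact hmin w hw hDw
  · rw [hg.coordEnergy_eq_excess hD]
    exact hg.excess_pos hu

end Nonlinearity

end Variational

/-! ### The Fourier transform: Parseval, translations, reality -/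

section Fourier

variable {d : ℕ}

theorem inner_characterLp_fourierTransform (x : Fin d → ℤ) (u : EllTwo d) :
    inner ℂ (characterLp x) (fourierTransform u) = (((2 * Real.pi) ^ d : ℝ) : ℂ) * (u x : ℂ) := by
  have h := (hasSum_fourierTransform u).mapL (innerSL ℂ (characterLp x))
  simp only [innerSL_apply_apply, inner_smul_right, inner_characterLp] at h
  rw [← h.tsum_eq, tsum_eq_single x fun y hy => by simp [hy.symm]]
  simp [mul_comm]

theorem norm_fourierTransform_sq (u : EllTwo d) :
    ‖fourierTransform u‖ ^ 2 = (2 * Real.pi) ^ d * ‖u‖ ^ 2 := by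
  have h := (hasSum_fourierTransform u).mapL (innerSL ℂ (fourierTransform u))
  have e1 : ∀ x, innerSL ℂ (fourierTransform u) ((u x : ℂ) • characterLp x)
      = (((2 * Real.pi) ^ d * u x ^ 2 : ℝ) : ℂ) := fun x => by
    rw [innerSL_apply_apply, inner_smul_right, ← inner_conj_symm,
      inner_characterLp_fourierTransform]
    simp only [map_mul, Complex.conj_ofReal]
    push_cast
    ring
  have e2 : innerSL ℂ (fourierTransform u) (fourierTransform u)
      = ((‖fourierTransform u‖ ^ 2 : ℝ) : ℂ) := by
    rw [innerSL_apply_apply, inner_self_eq_norm_sq_to_K, Complex.ofReal_pow]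
    rfl
  simp only [e1, e2] at h
  have h' := Complex.hasSum_ofReal.mp h
  rw [← h'.tsum_eq, tsum_mul_left, lp_norm_sq]

theorem integral_norm_fourierTransform_sq (u : EllTwo d) :
    ∫ θ, ‖fourierTransform u θ‖ ^ 2 ∂(cubeMeasure d) = (2 * Real.pi) ^ d * ‖u‖ ^ 2 := by
  rw [← norm_fourierTransform_sq]
  have h : inner ℂ (fourierTransform u) (fourierTransform u)
      = ((∫ θ, ‖fourierTransform u θ‖ ^ 2 ∂(cubeMeasure d) : ℝ) : ℂ) := by
    rw [L2.inner_def, ← integral_complex_ofReal]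
    refine integral_congr_ae (Eventually.of_forall fun θ => ?_)
    dsimp only
    rw [inner_self_eq_norm_sq_to_K]
    push_cast
    rfl
  rw [inner_self_eq_norm_sq_to_K] at h
  exact Complex.ofReal_injective (h.symm.trans (Complex.ofReal_pow _ _).symm)

theorem symbol_rpow_le {α : ℝ} (hα : 0 ≤ α) (θ : Fin d → ℝ) :
    symbol θ ^ α ≤ (4 * d : ℝ) ^ α := by
  refine Real.rpow_le_rpow (symbol_nonneg θ) ?_ hα
  calc symbol θ ≤ ∑ _i : Fin d, (4 : ℝ) :=
        Finset.sum_le_sum fun i _ => by nlinarith [Real.sin_sq_le_one (θ i / 2)]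
    _ = 4 * d := by simp [mul_comm]

theorem symbol_rpow_nonneg (α : ℝ) (θ : Fin d → ℝ) : 0 ≤ symbol θ ^ α :=
  Real.rpow_nonneg (symbol_nonneg θ) α

theorem integrable_norm_sq (p : Lp ℂ 2 (cubeMeasure d)) :
    Integrable (fun θ => ‖p θ‖ ^ 2) (cubeMeasure d) :=
  (Lp.memLp p).integrable_norm_pow two_ne_zero

theorem integrable_symbol_mul_norm_sq {α : ℝ} (hα : 0 ≤ α) (p : Lp ℂ 2 (cubeMeasure d)) :
    Integrable (fun θ => symbol θ ^ α * ‖p θ‖ ^ 2) (cubeMeasure d) := by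
  refine (integrable_norm_sq p).bdd_mul (c := (4 * d : ℝ) ^ α)
    (measurable_symbol_rpow α).aestronglyMeasurable (Eventually.of_forall fun θ => ?_)
  rw [Real.norm_of_nonneg (symbol_rpow_nonneg α θ)]
  exact symbol_rpow_le hα θ

theorem mem_hSubmodule {α : ℝ} (hα : 0 ≤ α) {h : (Fin d → ℤ) → ℝ} (hh : BoundedPositive h)
    (u : EllTwo d) : u ∈ hSubmodule α h := by
  refine ⟨integrable_symbol_mul_norm_sq hα _, ?_⟩
  obtain ⟨c₁, c₂, h₁, h₂, hc⟩ := hh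
  refine Summable.of_nonneg_of_le (fun x => mul_nonneg (h₁.le.trans (hc x).1) (sq_nonneg _))
    (fun x => ?_) ((summable_sq u).mul_left c₂)
  exact mul_le_mul_of_nonneg_right (hc x).2 (sq_nonneg _)

/-- Translation of a sequence by `z`. -/
def shift (z : Fin d → ℤ) (u : EllTwo d) : EllTwo d :=
  ⟨fun x => u (x + z), memℓp_gen (by
    have h := (summable_sq u).comp_injective (Equiv.addRight z).injective
    simpa [Function.comp_def] using h)⟩

@[simp] theorem shift_apply (z : Fin d → ℤ) (u : EllTwo d) (x : Fin d → ℤ) :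
    shift z u x = u (x + z) := rfl

theorem character_add (x y : Fin d → ℤ) (θ : Fin d → ℝ) :
    character (x + y) θ = character x θ * character y θ := by
  simp only [character]
  rw [← Complex.exp_add, ← mul_add, ← Finset.sum_add_distrib]
  congr 2
  refine Finset.sum_congr rfl fun i _ => ?_
  simp only [Pi.add_apply]
  push_cast
  ring

theorem conj_character (x : Fin d → ℤ) (θ : Fin d → ℝ) :
    starRingEnd ℂ (character x θ)
      = Complex.exp (-(Complex.I * ∑ i, (x i : ℂ) * (θ i : ℂ))) := by
  rw [character, ← Complex.exp_conj]
  congr 1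
  simp

theorem character_neg (x : Fin d → ℤ) (θ : Fin d → ℝ) :
    character x (-θ) = starRingEnd ℂ (character x θ) := by
  rw [conj_character, character]
  congr 1
  simp

theorem memLp_top_character (x : Fin d → ℤ) : MemLp (character x) ⊤ (cubeMeasure d) :=
  memLp_top_of_bound (continuous_character x).aestronglyMeasurable 1
    (Eventually.of_forall fun θ => (norm_character x θ).le)

theorem norm_fourierTransform_shift (z : Fin d → ℤ) (u : EllTwo d) :
    ∀ᵐ θ ∂(cubeMeasure d), ‖fourierTransform (shift z u) θ‖ = ‖fourierTransform u θ‖ := by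
  set m : Lp ℂ 2 (cubeMeasure d) →L[ℂ] Lp ℂ 2 (cubeMeasure d) :=
    (ContinuousLinearMap.mul ℂ ℂ).holderL (cubeMeasure d) ⊤ 2 2
      ((memLp_top_character z).toLp (character z))
  have hm : ∀ p : Lp ℂ 2 (cubeMeasure d), m p =ᵐ[cubeMeasure d] fun θ => character z θ * p θ :=
    fun p => by
      filter_upwards [(ContinuousLinearMap.mul ℂ ℂ).coeFn_holder (r := 2)
        ((memLp_top_character z).toLp (character z)) p,
        (memLp_top_character z).coeFn_toLp] with θ h1 h2
      change _ = _ at h1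
      rw [← h2]
      exact h1
  have hmc : ∀ x, m (characterLp x) = characterLp (x + z) := fun x => by
    refine Lp.ext ?_
    filter_upwards [hm (characterLp x), (memLp_character x).coeFn_toLp,
      (memLp_character (x + z)).coeFn_toLp] with θ h1 h2 h3
    rw [h1, characterLp, characterLp, h2, h3, character_add, mul_comm]
  have h1 := (hasSum_fourierTransform (shift z u)).mapL m
  have h2 := (Equiv.addRight z).hasSum_iff.mpr (hasSum_fourierTransform u)
  have h3 : m (fourierTransform (shift z u)) = fourierTransform u := by
    refine h1.unique ?_
    have e : ((fun x => (u x : ℂ) • characterLp x) ∘ Equiv.addRight z)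
        = fun x => m ((shift z u x : ℂ) • characterLp x) := by
      funext x
      simp only [map_smul, hmc, Function.comp_apply, Equiv.coe_addRight, shift_apply]
    rwa [e] at h2
  filter_upwards [hm (fourierTransform (shift z u))] with θ hθ
  rw [← h3, hθ, norm_mul, norm_character, one_mul]

theorem integral_comp_neg_cubeMeasure (F : (Fin d → ℝ) → ℂ) :
    ∫ θ, F (-θ) ∂(cubeMeasure d) = ∫ θ, F θ ∂(cubeMeasure d) := by
  have hs : (Neg.neg ⁻¹' (Set.univ.pi fun _ : Fin d => Set.Icc (-Real.pi) Real.pi))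
      = Set.univ.pi fun _ : Fin d => Set.Icc (-Real.pi) Real.pi := by
    ext θ
    simp only [Set.mem_preimage, Set.mem_univ_pi, Set.mem_Icc, Pi.neg_apply]
    exact forall_congr' fun i => by constructor <;> rintro ⟨h1, h2⟩ <;> constructor <;> linarith
  have hp := (Measure.measurePreserving_neg (volume : Measure (Fin d → ℝ))).restrict_preimage
    (MeasurableSet.univ_pi fun _ : Fin d => measurableSet_Icc (a := -Real.pi) (b := Real.pi))
  rw [hs] at hp
  exact hp.integral_comp (MeasurableEquiv.neg (Fin d → ℝ)).measurableEmbedding F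

theorem symbol_neg (θ : Fin d → ℝ) : symbol (-θ) = symbol θ := by
  simp [symbol, neg_div]

theorem memLp_symbol_mul_character {α : ℝ} (hα : 0 ≤ α) (x : Fin d → ℤ) :
    MemLp (fun θ => ((symbol θ ^ α : ℝ) : ℂ) * character x θ) 2 (cubeMeasure d) := by
  refine MemLp.of_bound ((Complex.continuous_ofReal.measurable.comp
    (measurable_symbol_rpow α)).aestronglyMeasurable.mul
      (continuous_character x).aestronglyMeasurable) ((4 * d : ℝ) ^ α)
    (Eventually.of_forall fun θ => ?_)
  rw [norm_mul, norm_character, mul_one, Complex.norm_real,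
    Real.norm_of_nonneg (symbol_rpow_nonneg α θ)]
  exact symbol_rpow_le hα θ

theorem fracLaplacian_eq (α : ℝ) (u : EllTwo d) (x : Fin d → ℤ) :
    fracLaplacian α u x = (((2 * Real.pi) ^ d)⁻¹ : ℝ) *
      ∫ θ, ((symbol θ ^ α : ℝ) : ℂ) * fourierTransform u θ * starRingEnd ℂ (character x θ)
        ∂(cubeMeasure d) := by
  simp only [fracLaplacian, inverseFourierTransform, conj_character]

/-- The fractional Laplacian of a real sequence is real. -/
theorem conj_fracLaplacian {α : ℝ} (hα : 0 ≤ α) (u : EllTwo d) (x : Fin d → ℤ) :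
    starRingEnd ℂ (fracLaplacian α u x) = fracLaplacian α u x := by
  set k := (memLp_symbol_mul_character hα x).toLp _
  have hk : ∀ p : Lp ℂ 2 (cubeMeasure d), inner ℂ k p
      = ∫ θ, ((symbol θ ^ α : ℝ) : ℂ) * p θ * starRingEnd ℂ (character x θ)
          ∂(cubeMeasure d) := fun p => by
    rw [L2.inner_def]
    refine integral_congr_ae ?_
    filter_upwards [(memLp_symbol_mul_character hα x).coeFn_toLp] with θ h1
    simp only [k, h1, RCLike.inner_apply, map_mul, Complex.conj_ofReal]
    ring
  have hreal : ∀ y, starRingEnd ℂ (inner ℂ k (characterLp y)) = inner ℂ k (characterLp y) :=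
    fun y => by
      have e : inner ℂ k (characterLp y) = ∫ θ, ((symbol θ ^ α : ℝ) : ℂ) * character y θ *
          starRingEnd ℂ (character x θ) ∂(cubeMeasure d) := by
        rw [hk]
        refine integral_congr_ae ?_
        filter_upwards [(memLp_character y).coeFn_toLp] with θ h1
        rw [characterLp, h1]
      rw [e, ← integral_conj, ← integral_comp_neg_cubeMeasure]
      congr 1
      funext θ
      simp [symbol_neg, character_neg]
  have hsum := (hasSum_fourierTransform u).mapL (innerSL ℂ k)
  have hsum' := hsum.map (starRingEnd ℂ) Complex.continuous_conj
  have hc : starRingEnd ℂ (inner ℂ k (fourierTransform u)) = inner ℂ k (fourierTransform u) := by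
    simp only [Function.comp_def, innerSL_apply_apply, inner_smul_right, map_mul,
      Complex.conj_ofReal, hreal] at hsum hsum'
    exact hsum'.unique hsum
  rw [fracLaplacian_eq, ← hk, map_mul, hc, Complex.conj_ofReal]

theorem fourierTransform_single (x : Fin d → ℤ) :
    fourierTransform (lp.single 2 x (1 : ℝ)) = characterLp x := by
  rw [fourierTransform, tsum_eq_single x fun y hy => by simp [hy]]
  simp

end Fourier

/-! ### `H^α` as an isomorphic copy of `ℓ²(ℤᵈ)` -/

section Isomorphism

variable {d : ℕ} {α : ℝ} {h : (Fin d → ℤ) → ℝ}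

theorem HSpace.toEllTwo_bijective (hα : 0 ≤ α) (hh : BoundedPositive h) :
    Function.Bijective (toEllTwo : HSpace α hh →ₗ[ℝ] EllTwo d) :=
  ⟨Subtype.val_injective, fun u => ⟨⟨u, mem_hSubmodule hα hh u⟩, rfl⟩⟩

theorem HSpace.exists_norm_toEllTwo_le (hh : BoundedPositive h) :
    ∃ C : ℝ, ∀ u : HSpace α hh, ‖toEllTwo u‖ ≤ C * ‖u‖ := by
  obtain ⟨c₁, c₂, h₁, h₂, hc⟩ := id hh
  refine ⟨Real.sqrt c₁⁻¹, fun u => ?_⟩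
  refine le_of_sq_le_sq ?_ (by positivity)
  rw [mul_pow, Real.sq_sqrt (by positivity), norm_sq_eq, lp_norm_sq, inv_mul_eq_div,
    le_div_iff₀ h₁, mul_comm, ← tsum_mul_left]
  have e1 : ∑' x, c₁ * u x ^ 2 ≤ ∑' x, h x * u x ^ 2 :=
    ((summable_sq (toEllTwo u)).mul_left c₁).tsum_le_tsum
      (fun x => mul_le_mul_of_nonneg_right (hc x).1 (sq_nonneg _)) u.summable_mul_sq
  have e2 : 0 ≤ ((2 * Real.pi) ^ d)⁻¹ *
      ∫ θ, symbol θ ^ α * ‖fourierTransform (toEllTwo u) θ‖ ^ 2 ∂(cubeMeasure d) :=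
    mul_nonneg (by positivity) (integral_nonneg fun θ =>
      mul_nonneg (symbol_rpow_nonneg α θ) (sq_nonneg _))
  linarith

theorem HSpace.exists_norm_le (hα : 0 ≤ α) (hh : BoundedPositive h) :
    ∃ C : ℝ, ∀ u : HSpace α hh, ‖u‖ ≤ C * ‖toEllTwo u‖ := by
  obtain ⟨c₁, c₂, h₁, h₂, hc⟩ := id hh
  refine ⟨Real.sqrt ((4 * d : ℝ) ^ α + c₂), fun u => ?_⟩
  refine le_of_sq_le_sq ?_ (by positivity)
  rw [mul_pow, Real.sq_sqrt (by positivity), norm_sq_eq, add_mul]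
  have e1 : ∑' x, h x * u x ^ 2 ≤ c₂ * ‖toEllTwo u‖ ^ 2 := by
    rw [lp_norm_sq, ← tsum_mul_left]
    exact u.summable_mul_sq.tsum_le_tsum
      (fun x => mul_le_mul_of_nonneg_right (hc x).2 (sq_nonneg _))
      ((summable_sq (toEllTwo u)).mul_left c₂)
  have e2 : ∫ θ, symbol θ ^ α * ‖fourierTransform (toEllTwo u) θ‖ ^ 2 ∂(cubeMeasure d)
      ≤ (4 * d : ℝ) ^ α * ((2 * Real.pi) ^ d * ‖toEllTwo u‖ ^ 2) := by
    rw [← integral_norm_fourierTransform_sq, ← integral_const_mul]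
    exact integral_mono u.integrable_sq ((integrable_norm_sq _).const_mul _) fun θ =>
      mul_le_mul_of_nonneg_right (symbol_rpow_le hα θ) (sq_nonneg _)
  have e3 : ((2 * Real.pi) ^ d)⁻¹ * ((4 * d : ℝ) ^ α * ((2 * Real.pi) ^ d * ‖toEllTwo u‖ ^ 2))
      = (4 * d : ℝ) ^ α * ‖toEllTwo u‖ ^ 2 := by
    field_simp
  have e4 := mul_le_mul_of_nonneg_left e2 (by positivity : 0 ≤ ((2 * Real.pi) ^ d)⁻¹)
  linarith

/-- For `α ≥ 0` the symbol is bounded, and `H^α` is `ℓ²(ℤᵈ)` with an equivalent norm. -/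
def HSpace.equivEllTwo (hα : 0 ≤ α) (hh : BoundedPositive h) : HSpace α hh ≃L[ℝ] EllTwo d :=
  (LinearEquiv.ofBijective toEllTwo (toEllTwo_bijective hα hh)).toContinuousLinearEquivOfBounds
    (exists_norm_toEllTwo_le hh).choose (exists_norm_le hα hh).choose
    (exists_norm_toEllTwo_le hh).choose_spec fun u => by
      have e := (exists_norm_le hα hh).choose_spec
        ((LinearEquiv.ofBijective toEllTwo (toEllTwo_bijective hα hh)).symm u)
      rwa [← LinearEquiv.ofBijective_apply toEllTwo (hf := toEllTwo_bijective hα hh),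
        LinearEquiv.apply_symm_apply] at e

@[simp] theorem HSpace.equivEllTwo_apply (hα : 0 ≤ α) (hh : BoundedPositive h)
    (u : HSpace α hh) : equivEllTwo hα hh u = toEllTwo u := rfl

theorem HSpace.exists_shift (hα : 0 ≤ α) (hh : BoundedPositive h) (hper : ∀ x, h x = h 0)
    (z : Fin d → ℤ) (u : HSpace α hh) :
    ∃ u' : HSpace α hh, ‖u'‖ = ‖u‖ ∧ ∀ x, u' x = u (x + z) := by
  obtain ⟨u', hu'⟩ := (toEllTwo_bijective hα hh).2 (shift z (toEllTwo u))
  refine ⟨u', ?_, fun x => by rw [hu', shift_apply]⟩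
  rw [← sq_eq_sq₀ (norm_nonneg _) (norm_nonneg _), norm_sq_eq, norm_sq_eq, hu']
  congr 1
  · congr 1
    refine integral_congr_ae ?_
    filter_upwards [norm_fourierTransform_shift z (toEllTwo u)] with θ hθ
    rw [hθ]
  · rw [← (Equiv.addRight z).tsum_eq fun x => h x * u x ^ 2]
    refine tsum_congr fun x => ?_
    rw [Equiv.coe_addRight, shift_apply, hper x, hper (x + z)]

theorem HSpace.inner_single (hh : BoundedPositive h) (u v : HSpace α hh)
    (x : Fin d → ℤ) (hv : toEllTwo v = lp.single 2 x (1 : ℝ)) :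
    inner ℝ u v = (fracLaplacian α (toEllTwo u) x).re + h x * u x := by
  change form u v = _
  rw [form, hv, fourierTransform_single, fracLaplacian_eq, Complex.re_ofReal_mul]
  congr 1
  · congr 2
    refine integral_congr_ae ?_
    filter_upwards [(memLp_character x).coeFn_toLp] with θ hθ
    rw [characterLp, hθ]
  · rw [tsum_eq_single x fun y hy => by simp [hy]]
    simp

end Isomorphism

theorem eq_apply_zero_of_periodic {d : ℕ} {β : Type*} {F : (Fin d → ℤ) → β}
    (hF : ∀ x i, F (x + Pi.single i 1) = F x) (x : Fin d → ℤ) : F x = F 0 := by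
  have h1 : ∀ (n : ℤ) (i : Fin d) (x : Fin d → ℤ), F (x + Pi.single i n) = F x := by
    intro n i
    induction n using Int.induction_on with
    | zero => intro x; simp
    | succ n ih =>
      intro x
      rw [Pi.single_add, ← add_assoc, hF, ih]
    | pred n ih =>
      intro x
      have e : (x + Pi.single i (-(n : ℤ) - 1) : Fin d → ℤ) + Pi.single i 1
          = x + Pi.single i (-(n : ℤ)) := by
        rw [add_assoc, ← Pi.single_add, sub_add_cancel]
      rw [← hF _ i, e, ih]
  have h2 : ∀ s : Finset (Fin d), F (∑ i ∈ s, Pi.single i (x i)) = F 0 := by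
    intro s
    induction s using Finset.induction_on with
    | empty => simp
    | insert i s hi ih => rw [Finset.sum_insert hi, add_comm, h1, ih]
  rw [← h2 Finset.univ, Finset.univ_sum_single]

theorem isSolution_of_hasFDerivAt_zero {d : ℕ} {α : ℝ} (hα : 0 ≤ α) {h : (Fin d → ℤ) → ℝ}
    (hh : BoundedPositive h) {g : ℝ → ℝ} (hg : Nonlinearity g) {u : HSpace α hh}
    (hu : HasFDerivAt (coordEnergy (HSpace.equivEllTwo hα hh) g) (0 : HSpace α hh →L[ℝ] ℝ) u) :
    IsSolution α h (fun _ => g) (HSpace.toEllTwo u) := by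
  intro x
  have h1 := (hg.hasStrictFDerivAt_coordEnergy
    (T := HSpace.equivEllTwo hα hh) u).hasFDerivAt.unique hu
  obtain ⟨v, hv⟩ := (HSpace.toEllTwo_bijective hα hh).2 (lp.single 2 x (1 : ℝ))
  have h2 := DFunLike.congr_fun h1 v
  simp only [sub_apply, innerSL_apply_apply, ContinuousLinearMap.comp_apply,
    ContinuousLinearEquiv.coe_coe, HSpace.equivEllTwo_apply, zero_apply,
    HSpace.inner_single hh u v x hv, hv, lp.inner_single_right] at h2
  have h3 : (fracLaplacian α (HSpace.toEllTwo u) x).re + h x * u x = g (u x) := by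
    simpa [sub_eq_zero] using h2
  have h4 := Complex.conj_eq_iff_re.mp (conj_fracLaplacian hα (HSpace.toEllTwo u) x)
  beta_reduce
  rw [← h4, ← h3]
  push_cast
  ring

end FracSchrodinger

end

theorem theorem1p1 {d : ℕ} (hd : 1 ≤ d) {α : ℝ} (hα₀ : 0 < α) (hα₁ : α < 1)
    (h : (Fin d → ℤ) → ℝ) (f : (Fin d → ℤ) → ℝ → ℝ)
    (hh : FracSchrodinger.BoundedPositive h)
    (hf₁ : ∀ x, Continuous (f x))
    (hf₂ : ∃ a p : ℝ, 0 < a ∧ 2 < p ∧ ∀ x u, |f x u| ≤ a * (1 + |u| ^ (p - 1)))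
    (hf₃ : ∀ ε : ℝ, 0 < ε → ∃ δ : ℝ, 0 < δ ∧ ∀ x u, |u| < δ → |f x u| ≤ ε * |u|)
    (hf₄ : ∀ x, StrictMonoOn (fun u => f x u / |u|) (Set.Iio 0) ∧
      StrictMonoOn (fun u => f x u / |u|) (Set.Ioi 0))
    (hf₅ : ∀ M : ℝ, ∃ R : ℝ, 0 < R ∧
      ∀ x u, R ≤ |u| → M ≤ FracSchrodinger.primitive f x u / u ^ 2)
    (hf₆ : ∀ (x : Fin d → ℤ) (i : Fin d),
      h (x + Pi.single i 1) = h x ∧ ∀ u, f (x + Pi.single i 1) u = f x u) :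
    ∃ u : FracSchrodinger.HSpace α hh,
      FracSchrodinger.IsGroundState f u ∧ FracSchrodinger.IsSolution α h f u.toEllTwo := by
  have hper : ∀ x, h x = h 0 :=
    FracSchrodinger.eq_apply_zero_of_periodic fun x i => (hf₆ x i).1
  obtain ⟨g, rfl⟩ : ∃ g : ℝ → ℝ, f = fun _ => g :=
    ⟨f 0, funext (FracSchrodinger.eq_apply_zero_of_periodic fun x i => funext (hf₆ x i).2)⟩
  have hg : FracSchrodinger.Nonlinearity g := by
    refine ⟨⟨hf₁ 0, fun ε hε => ?_⟩, (hf₄ 0).1, (hf₄ 0).2, fun M => ?_⟩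
    · obtain ⟨δ, hδ, hb⟩ := hf₃ ε hε
      exact ⟨δ, hδ, fun u hu => by simpa using hb 0 u hu⟩
    · obtain ⟨R, hR, hb⟩ := hf₅ M
      exact ⟨R, hR, hb 0⟩
  obtain ⟨u, hu, hcrit, hglb, hpos⟩ := hg.exists_groundState
    (T := FracSchrodinger.HSpace.equivEllTwo hα₀.le hh) 0 fun y u => by
      obtain ⟨u', hn, hx⟩ := FracSchrodinger.HSpace.exists_shift hα₀.le hh hper y u
      exact ⟨u', hn, Equiv.addRight y, by simp, hx⟩
  exact ⟨u, ⟨hu, hcrit, hglb, hpos⟩,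
    FracSchrodinger.isSolution_of_hasFDerivAt_zero hα₀.le hh hg hcrit⟩
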